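/- Let $\mathbb{T}=\mathbb{R}/\mathbb{Z}$ and, for $f\in\mathbb{T}$, let $a(f)=[1,e^{2\pi i f},\dots,e^{2\pi i(N-1)f}]^T\in\mathbb{C}^N$. Let $K<N$, let $f_1,\dots,f_K\in\mathbb{T}$ be distinct, put $A(f)=[a(f_1),\dots,a(f_K)]\in\mathbb{C}^{N\times K}$, let $S\in\mathbb{C}^{K\times L}$ have full row rank $K$, and let $Y=A(f)S$. (No separation between the frequencies is assumed beyond their being distinct.) For $\epsilon>0$ put $$\hat R=\tfrac1L YY^H,\qquad W=W_\epsilon=(I+\epsilon^{-1}\hat R)^{-1},\qquad w(f)=\sqrt{a(f)^HWa(f)},$$ let the weighted atomic norm of $Y$ be $$\|Y\|_{\mathcal{A}^w}=\inf\Big\{\sum_k w(g_k)c_k:\ Y=\sum_k c_k\,a(g_k)\phi_k \text{ (finite sum)},\ c_k>0,\ g_k\in\mathbb{T},\ \phi_k\in\mathbb{C}^{1\times L},\ \|\phi_k\|_2=1\Big\},$$ and consider the semidefinite program $$\min_{X,T}\ \tfrac12\operatorname{tr}(X)+\tfrac12\operatorname{tr}(WT)\quad\text{subject to}\quad\begin{bmatrix}X&Y^H\\Y&T\end{bmatrix}\succeq0,\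 T\in\mathbb{C}^{N\times N}\text{ Toeplitz}.\qquad(\mathrm{WAN})$$ A Vandermonde decomposition of $T$ is a representation $T=\sum_{k=1}^{n}p_k\,a(g_k)a(g_k)^H$ with $n=\operatorname{rank}T$, $p_k>0$ and $g_1,\dots,g_n\in\mathbb{T}$ distinct. Then there is $\epsilon_0>0$, which may depend on $N$, $f$ and $S$, such that for every $0<\epsilon\le\epsilon_0$: the minimum in (WAN) is attained and equals $\|Y\|_{\mathcal{A}^w}$; and for every optimal solution $(X,T)$ of (WAN), $T$ has a Vandermonde decomposition, and every Vandermonde decomposition of $T$ has exactly $K$ terms, with $\{g_1,\dots,g_K\}=\{f_1,\dots,f_K\}$. -/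

import Mathlib

open Matrix
open scoped ComplexOrder

namespace WAN

/-- The sampled complex sinusoid `a(f) = [1, e^{2πif}, …, e^{2πi(N-1)f}]ᵀ` of frequency `f` on the
unit circle `𝕋 = ℝ / ℤ`. -/
noncomputable def sinusoid (N : ℕ) (f : UnitAddCircle) : Fin N → ℂ :=
  fun j => fourier (j : ℤ) f

/-- On a real representative `x` of the frequency, entry `j` of `a(x)` is `e^{2πijx}`. -/
theorem sinusoid_coe (N : ℕ) (x : ℝ) (j : Fin N) :
    sinusoid N (x : UnitAddCircle) j = Complex.exp (2 * Real.pi * Complex.I * (j : ℕ) * x) := by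
  simp only [sinusoid, fourier_coe_apply]
  simp

/-- The `N × K` Vandermonde matrix `A(f) = [a(f₁), …, a(f_K)]`. -/
noncomputable def vandermondeMatrix (N : ℕ) {K : ℕ} (f : Fin K → UnitAddCircle) :
    Matrix (Fin N) (Fin K) ℂ :=
  Matrix.of fun j k => sinusoid N (f k) j

/-- The sample covariance matrix `R̂ = (1/L) Y Yᴴ`. -/
noncomputable def sampleCov {N L : ℕ} (Y : Matrix (Fin N) (Fin L) ℂ) :
    Matrix (Fin N) (Fin N) ℂ :=
  (1 / (L : ℂ)) • (Y * Yᴴ)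

/-- The weight matrix `W = (I + ε⁻¹ R̂)⁻¹`. -/
noncomputable def weightMatrix {N L : ℕ} (ε : ℝ) (Y : Matrix (Fin N) (Fin L) ℂ) :
    Matrix (Fin N) (Fin N) ℂ :=
  (1 + ((ε⁻¹ : ℝ) : ℂ) • sampleCov Y)⁻¹

/-- The weighting function `w(f) = √(a(f)ᴴ W a(f))`; for positive semidefinite `W` the quadratic
form is a nonnegative real number. -/
noncomputable def weight {N : ℕ} (W : Matrix (Fin N) (Fin N) ℂ) (f : UnitAddCircle) : ℝ :=
  Real.sqrt (star (sinusoid N f) ⬝ᵥ (W *ᵥ sinusoid N f)).re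

/-- The atom `a(f) φ`, the product of the column `a(f)` and the row `φ`. -/
noncomputable def atom (N : ℕ) {L : ℕ} (f : UnitAddCircle) (φ : EuclideanSpace ℂ (Fin L)) :
    Matrix (Fin N) (Fin L) ℂ :=
  Matrix.of fun j l => sinusoid N f j * φ l

/-- The costs `∑ₖ w(fₖ) cₖ` of all (finite) atomic decompositions `Y = ∑ₖ cₖ a(fₖ) φₖ` with
`cₖ > 0` and `‖φₖ‖₂ = 1`. -/
def atomicCosts {N L : ℕ} (w : UnitAddCircle → ℝ) (Y : Matrix (Fin N) (Fin L) ℂ) : Set ℝ :=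
  {r | ∃ (n : ℕ) (c : Fin n → ℝ) (g : Fin n → UnitAddCircle) (φ : Fin n → EuclideanSpace ℂ (Fin L)),
    (∀ k, 0 < c k) ∧ (∀ k, ‖φ k‖ = 1) ∧
    Y = ∑ k, (c k : ℂ) • atom N (g k) (φ k) ∧
    r = ∑ k, w (g k) * c k}

/-- The weighted atomic norm of `Y`. -/
noncomputable def weightedAtomicNorm {N L : ℕ} (w : UnitAddCircle → ℝ)
    (Y : Matrix (Fin N) (Fin L) ℂ) : ℝ :=
  sInf (atomicCosts w Y)

/-- A Toeplitz matrix: the entries depend only on the difference of the indices. -/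
def IsToeplitz {N : ℕ} (T : Matrix (Fin N) (Fin N) ℂ) : Prop :=
  ∃ t : ℤ → ℂ, ∀ i j : Fin N, T i j = t ((i : ℤ) - (j : ℤ))

/-- Feasibility of `(X, T)` for the semidefinite program: `[X, Yᴴ; Y, T] ≽ 0`, `T` Toeplitz. -/
def Feasible {N L : ℕ} (Y : Matrix (Fin N) (Fin L) ℂ)
    (X : Matrix (Fin L) (Fin L) ℂ) (T : Matrix (Fin N) (Fin N) ℂ) : Prop :=
  (Matrix.fromBlocks X Yᴴ Y T).PosSemidef ∧ IsToeplitz T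

/-- The objective `½ tr X + ½ tr (W T)`; both traces are real at feasible points if `W ≽ 0`. -/
noncomputable def objective {N L : ℕ} (W : Matrix (Fin N) (Fin N) ℂ)
    (X : Matrix (Fin L) (Fin L) ℂ) (T : Matrix (Fin N) (Fin N) ℂ) : ℝ :=
  (1 / 2) * X.trace.re + (1 / 2) * (W * T).trace.re

/-- The objective values of the semidefinite program. -/
def objectiveValues {N L : ℕ} (W : Matrix (Fin N) (Fin N) ℂ) (Y : Matrix (Fin N) (Fin L) ℂ) :
    Set ℝ :=
  {r | ∃ X T, Feasible Y X T ∧ r = objective W X T}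

/-- `(X, T)` is an optimal solution of the semidefinite program
`min ½ tr X + ½ tr (W T)` subject to `[X, Yᴴ; Y, T] ≽ 0` and `T` Toeplitz. -/
def IsOptimal {N L : ℕ} (W : Matrix (Fin N) (Fin N) ℂ) (Y : Matrix (Fin N) (Fin L) ℂ)
    (X : Matrix (Fin L) (Fin L) ℂ) (T : Matrix (Fin N) (Fin N) ℂ) : Prop :=
  Feasible Y X T ∧ ∀ X' T', Feasible Y X' T' → objective W X T ≤ objective W X' T'

/-- `T = A(g) diag(p) A(g)ᴴ` is a Vandermonde decomposition of `T`: the frequencies `gₖ` are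
distinct, the powers `pₖ` are positive, and the number of terms is the rank of `T`. -/
def IsVandermondeDecomposition {N n : ℕ} (T : Matrix (Fin N) (Fin N) ℂ)
    (g : Fin n → UnitAddCircle) (p : Fin n → ℝ) : Prop :=
  Function.Injective g ∧ (∀ k, 0 < p k) ∧ n = T.rank ∧
    T = vandermondeMatrix N g * Matrix.diagonal (fun k => (p k : ℂ)) * (vandermondeMatrix N g)ᴴ

end WAN

/-! ### Sinusoids as polynomial evaluations; Lagrange interpolation at the nodes. -/

namespace WAN

open Polynomial

/-! The proof is convex duality with an explicit dual certificate. Put d_k = w(f_k)/‖S_k‖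
(`weightRatio`) and D = diag(d). The pair X = SᴴDS, T = AD⁻¹Aᴴ is feasible with value v = ∑
w(f_k)‖S_k‖, which is also the cost of the decomposition of Y by the rows of S. Conversely, a matrix
Q with QᴴA = SᴴD has Re tr(QᴴY) = v, and bounds both the program and the atomic norm below by v as
soon as tr((W − QQᴴ)T) ≥ 0 for all positive semidefinite Toeplitz T. `exists_certificate` gives
more: this trace is at least δ times the form of T at q, the coefficient vector of the nodal
polynomial ∏(z − z_k). So an optimal T annihilates q, and `IsToeplitz.exists_eq_diagonal` then
places T on the true frequencies.

The certificate is Qᴴ = SᴴDΛ + Θ, where Λ holds the Lagrange polynomials ℓ_k and ΘA = 0. The choice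
of d gives J = AᴴWA − DSSᴴD a zero diagonal. The remaining products of conj(ℓ_j) and ℓ_k, j ≠ k,
vanish only to first order at the nodes f_j and f_k, whereas nonnegativity needs second order. The
part of Θ along q supplies the correction, after which a constant multiple of |q|² is left
(`star_eval_nodeBasis_mul`); this suffices because Toeplitz matrices only see values on sinusoids
(`IsToeplitz.trace_mul_eq_zero`). As ε → 0, W stays the identity on the orthogonal complement of the
range of A, while AᴴW = O(ε) and d_k is at least of order √ε. Hence Θ and the multiple of |q|² tend
to 0 and the identity on the complement dominates them, however close the frequencies are. -/

/-- The point of the unit circle with angular coordinate `f`. -/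
noncomputable def circlePoint (f : UnitAddCircle) : ℂ := (AddCircle.toCircle f : ℂ)

lemma circlePoint_injective : Function.Injective circlePoint := fun _ _ h =>
  AddCircle.injective_toCircle one_ne_zero (Circle.coe_injective h)

lemma circlePoint_ne_zero (f : UnitAddCircle) : circlePoint f ≠ 0 := Circle.coe_ne_zero _

lemma star_circlePoint (f : UnitAddCircle) : star (circlePoint f) = (circlePoint f)⁻¹ := by
  simp [circlePoint, ← Circle.coe_inv_eq_conj]

lemma sinusoid_apply (N : ℕ) (f : UnitAddCircle) (i : Fin N) :
    sinusoid N f i = circlePoint f ^ (i : ℕ) := by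
  simp only [sinusoid, fourier_apply, AddCircle.toCircle_zsmul, circlePoint]
  simp

/-- The first `N` coefficients of a polynomial. -/
def coeffVec (N : ℕ) (P : ℂ[X]) : Fin N → ℂ := fun i => P.coeff i

/-- The pairing is bilinear, so the forms below conjugate the right-hand coefficient vector: for T =
a aᴴ the form of P and Q is P(z) times the conjugate of Q(z). -/
lemma coeffVec_dotProduct_sinusoid {N : ℕ} {P : ℂ[X]} (hP : P.natDegree < N)
    (f : UnitAddCircle) : coeffVec N P ⬝ᵥ sinusoid N f = P.eval (circlePoint f) := by
  rw [Polynomial.eval_eq_sum_range' hP, ← Fin.sum_univ_eq_sum_range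
    (fun i => P.coeff i * circlePoint f ^ i)]
  simp [dotProduct, coeffVec, sinusoid_apply]

lemma coeffVec_add (N : ℕ) (P Q : ℂ[X]) : coeffVec N (P + Q) = coeffVec N P + coeffVec N Q := by
  ext; simp [coeffVec]

lemma coeffVec_C_mul (N : ℕ) (c : ℂ) (P : ℂ[X]) : coeffVec N (C c * P) = c • coeffVec N P := by
  ext; simp [coeffVec]

/-- Multiplication by the variable preserves the form of a Toeplitz matrix. -/
lemma IsToeplitz.form_X_mul {N : ℕ} {T : Matrix (Fin N) (Fin N) ℂ} (hT : IsToeplitz T)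
    {P Q : ℂ[X]} (hP : P.natDegree + 1 < N) (hQ : Q.natDegree + 1 < N) :
    coeffVec N (X * P) ⬝ᵥ (T *ᵥ star (coeffVec N (X * Q))) =
      coeffVec N P ⬝ᵥ (T *ᵥ star (coeffVec N Q)) := by
  obtain ⟨t, ht⟩ := hT
  obtain ⟨n, rfl⟩ : ∃ n, N = n + 1 := ⟨N - 1, by omega⟩
  -- The shifted vectors vanish at index 0 and the unshifted ones at the last index, so both forms
  -- run over `n` × `n` index pairs that differ by a shift along the diagonal.
  have hP0 : P.coeff n = 0 := coeff_eq_zero_of_natDegree_lt (by omega)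
  have hQ0 : Q.coeff n = 0 := coeff_eq_zero_of_natDegree_lt (by omega)
  simp only [dotProduct, mulVec, coeffVec, Pi.star_apply, ht]
  conv_lhs => rw [Fin.sum_univ_succ]
  conv_rhs => rw [Fin.sum_univ_castSucc]
  simp only [Fin.val_zero, coeff_X_mul_zero, zero_mul, zero_add, Fin.val_last, hP0, add_zero]
  refine Finset.sum_congr rfl fun i _ => ?_
  conv_lhs => rw [Fin.sum_univ_succ]
  conv_rhs => rw [Fin.sum_univ_castSucc]
  simp [hQ0]

section nodes

variable {N K : ℕ} (f : Fin K → UnitAddCircle)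

/-- The monic polynomial whose roots are the points of the frequencies `f`. -/
noncomputable def nodePoly : ℂ[X] := Lagrange.nodal Finset.univ fun k => circlePoint (f k)

/-- The Lagrange polynomials of the points of the frequencies `f`. -/
noncomputable def nodeBasis (k : Fin K) : ℂ[X] :=
  Lagrange.basis Finset.univ (fun k => circlePoint (f k)) k

/-- The matrix of the coefficients of the Lagrange polynomials. -/
noncomputable def lagrangeMatrix (N : ℕ) {K : ℕ} (f : Fin K → UnitAddCircle) :
    Matrix (Fin K) (Fin N) ℂ :=
  Matrix.of fun k => coeffVec N (nodeBasis f k)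

/-- The coefficients of the nodal polynomial. -/
noncomputable def nodeVec (N : ℕ) {K : ℕ} (f : Fin K → UnitAddCircle) : Fin N → ℂ :=
  coeffVec N (nodePoly f)

lemma natDegree_nodePoly : (nodePoly f).natDegree = K := by
  simp [nodePoly, Lagrange.natDegree_nodal]

lemma eval_nodePoly_eq_zero_iff (g : UnitAddCircle) :
    (nodePoly f).eval (circlePoint g) = 0 ↔ g ∈ Set.range f := by
  simp only [nodePoly, Lagrange.eval_nodal, Finset.prod_eq_zero_iff, sub_eq_zero,
    Finset.mem_univ, true_and, circlePoint_injective.eq_iff, Set.mem_range]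
  simp only [eq_comm]

variable {f}

lemma injOn_circlePoint (hf : Function.Injective f) :
    Set.InjOn (fun k => circlePoint (f k)) (Finset.univ : Finset (Fin K)) :=
  (circlePoint_injective.comp hf).injOn

lemma natDegree_nodeBasis (hf : Function.Injective f) (k : Fin K) :
    (nodeBasis f k).natDegree = K - 1 := by
  rw [nodeBasis, Lagrange.natDegree_basis (injOn_circlePoint hf) (Finset.mem_univ k)]
  simp

lemma eval_nodeBasis (hf : Function.Injective f) (k j : Fin K) :
    (nodeBasis f k).eval (circlePoint (f j)) = if k = j then 1 else 0 := by
  split_ifs with h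
  · subst h
    exact Lagrange.eval_basis_self (injOn_circlePoint hf) (Finset.mem_univ k)
  · exact Lagrange.eval_basis_of_ne (v := fun k => circlePoint (f k)) h (Finset.mem_univ j)

/-- Away from the nodes, the Lagrange polynomials are multiples of `q(z) / (z - zₖ)`. -/
lemma eval_nodeBasis_of_ne (k : Fin K) {g : UnitAddCircle} (hg : g ≠ f k) :
    (nodeBasis f k).eval (circlePoint g) = (nodePoly f).eval (circlePoint g) *
      (Lagrange.nodalWeight Finset.univ (fun k => circlePoint (f k)) k *
        (circlePoint g - circlePoint (f k))⁻¹) :=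
  Lagrange.eval_basis_not_at_node (v := fun k => circlePoint (f k)) (Finset.mem_univ k)
    fun h => hg (circlePoint_injective h)

lemma lagrangeMatrix_mulVec_sinusoid (hKN : K < N) (hf : Function.Injective f)
    (g : UnitAddCircle) (k : Fin K) :
    (lagrangeMatrix N f *ᵥ sinusoid N g) k = (nodeBasis f k).eval (circlePoint g) :=
  coeffVec_dotProduct_sinusoid (P := nodeBasis f k) (by rw [natDegree_nodeBasis hf]; omega) g

lemma nodeVec_dotProduct_sinusoid (hKN : K < N) (g : UnitAddCircle) :
    nodeVec N f ⬝ᵥ sinusoid N g = (nodePoly f).eval (circlePoint g) :=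
  coeffVec_dotProduct_sinusoid (by rw [natDegree_nodePoly]; omega) g

/-- Below, this left inverse stands in for the linear independence of the columns of A. -/
lemma lagrangeMatrix_mul_vandermondeMatrix (hKN : K < N) (hf : Function.Injective f) :
    lagrangeMatrix N f * vandermondeMatrix N f = 1 := by
  ext k j
  rw [Matrix.one_apply, ← eval_nodeBasis hf, ← lagrangeMatrix_mulVec_sinusoid hKN hf]
  rfl

lemma nodeVec_vecMul_vandermondeMatrix (hKN : K < N) :
    nodeVec N f ᵥ* vandermondeMatrix N f = 0 := by
  ext k
  rw [Pi.zero_apply, ← (eval_nodePoly_eq_zero_iff f (f k)).2 ⟨k, rfl⟩,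
    ← nodeVec_dotProduct_sinusoid hKN]
  rfl

/-- The coefficient of the first-order correction of the product of two Lagrange polynomials. -/
noncomputable def nodeCorrection (f : Fin K → UnitAddCircle) (j k : Fin K) : ℂ :=
  Lagrange.nodalWeight Finset.univ (fun k => circlePoint (f k)) j /
    (circlePoint (f k) - circlePoint (f j))

/-- The ratio of the corrected product of two Lagrange polynomials to `|q|²`. -/
noncomputable def nodeRatio (f : Fin K → UnitAddCircle) (j k : Fin K) : ℂ :=
  -(star (Lagrange.nodalWeight Finset.univ (fun k => circlePoint (f k)) j) *
    Lagrange.nodalWeight Finset.univ (fun k => circlePoint (f k)) k * circlePoint (f j)) /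
      (circlePoint (f k) - circlePoint (f j))

/-- On the unit circle, the product of two Lagrange polynomials is, up to a first-order
correction by the nodal polynomial `q`, a constant multiple of `|q|²`. -/
lemma star_eval_nodeBasis_mul (hf : Function.Injective f) {j k : Fin K} (hjk : j ≠ k)
    (g : UnitAddCircle) :
    star ((nodeBasis f j).eval (circlePoint g)) * (nodeBasis f k).eval (circlePoint g)
      - star (nodeCorrection f j k) * (nodeBasis f k).eval (circlePoint g) *
        star ((nodePoly f).eval (circlePoint g))
      - nodeCorrection f k j * star ((nodeBasis f j).eval (circlePoint g)) *
        (nodePoly f).eval (circlePoint g) =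
    nodeRatio f j k * (star ((nodePoly f).eval (circlePoint g)) *
      (nodePoly f).eval (circlePoint g)) := by
  by_cases hj : g = f j
  · subst hj
    rw [(eval_nodePoly_eq_zero_iff f (f j)).2 ⟨j, rfl⟩, eval_nodeBasis hf k j, if_neg hjk.symm]
    simp
  by_cases hk : g = f k
  · subst hk
    rw [(eval_nodePoly_eq_zero_iff f (f k)).2 ⟨k, rfl⟩, eval_nodeBasis hf j k, if_neg hjk]
    simp
  -- Away from both nodes every term is |q|² times a rational function of z, since the conjugate of
  -- z is z⁻¹. The claim is then a partial fraction identity: the corrections remove the simple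
  -- poles at z_j and z_k and leave a constant.
  have h1 : circlePoint g - circlePoint (f j) ≠ 0 :=
    sub_ne_zero.2 fun h => hj (circlePoint_injective h)
  have h2 : circlePoint g - circlePoint (f k) ≠ 0 :=
    sub_ne_zero.2 fun h => hk (circlePoint_injective h)
  have h3 : circlePoint (f k) - circlePoint (f j) ≠ 0 :=
    sub_ne_zero.2 fun h => hjk (hf (circlePoint_injective h)).symm
  rw [eval_nodeBasis_of_ne j hj, eval_nodeBasis_of_ne k hk, nodeCorrection, nodeCorrection,
    nodeRatio]
  simp only [star_mul', star_inv₀, star_sub, star_div₀, star_circlePoint]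
  generalize Lagrange.nodalWeight Finset.univ (fun k => circlePoint (f k)) j = cj
  generalize Lagrange.nodalWeight Finset.univ (fun k => circlePoint (f k)) k = ck
  generalize (nodePoly f).eval (circlePoint g) = q
  have hz := circlePoint_ne_zero g
  have hzj := circlePoint_ne_zero (f j)
  have hzk := circlePoint_ne_zero (f k)
  generalize circlePoint g = z at *
  generalize circlePoint (f j) = u at *
  generalize circlePoint (f k) = v at *
  have e1 : (z⁻¹ - u⁻¹)⁻¹ = -(z * u) * (z - u)⁻¹ := by
    have : z⁻¹ - u⁻¹ = -((z - u) / (z * u)) := by field_simp; ring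
    rw [this, inv_neg, inv_div]; ring
  have e2 : (v⁻¹ - u⁻¹)⁻¹ = -(v * u) * (v - u)⁻¹ := by
    have : v⁻¹ - u⁻¹ = -((v - u) / (v * u)) := by field_simp; ring
    rw [this, inv_neg, inv_div]; ring
  have e3 : (u - v)⁻¹ = -(v - u)⁻¹ := by rw [← inv_neg, neg_sub]
  rw [div_eq_mul_inv, div_eq_mul_inv, e1, e2, e3]
  field_simp
  ring

end nodes

end WAN

/-! ### Toeplitz pairings, and Toeplitz matrices annihilating the nodal polynomial. -/

namespace WAN

open Polynomial

lemma linearIndependent_fourier :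
    LinearIndependent ℂ (fun n : ℤ => (fourier n : C(UnitAddCircle, ℂ))) :=
  LinearIndependent.of_comp
    (ContinuousMap.toLp (E := ℂ) 2 AddCircle.haarAddCircle ℂ).toLinearMap
    (orthonormal_fourier (T := 1)).linearIndependent

/-- The pairing of a matrix with Toeplitz matrices is determined by its quadratic form on the
sampled sinusoids. -/
lemma IsToeplitz.trace_mul_eq_zero {N : ℕ} {T E : Matrix (Fin N) (Fin N) ℂ} (hT : IsToeplitz T)
    (hE : ∀ f, star (sinusoid N f) ⬝ᵥ (E *ᵥ sinusoid N f) = 0) : (E * T).trace = 0 := by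
  obtain ⟨t, ht⟩ := hT
  -- `e` sums E along its diagonals. These sums are the Fourier coefficients of aᴴEa, hence zero;
  -- paired with `t` they give the trace.
  let e : ℤ →₀ ℂ := ∑ i : Fin N, ∑ j : Fin N, Finsupp.single ((j : ℤ) - (i : ℤ)) (E i j)
  have he : e = 0 := by
    refine linearIndependent_iff.1 linearIndependent_fourier e ?_
    ext f
    simp only [e, map_sum, Finsupp.linearCombination_single, ContinuousMap.coe_sum,
      Finset.sum_apply, ContinuousMap.coe_smul, Pi.smul_apply, smul_eq_mul,
      ContinuousMap.zero_apply]
    rw [← hE f]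
    simp only [dotProduct, mulVec, Finset.mul_sum, Pi.star_apply, sinusoid]
    refine Finset.sum_congr rfl fun i _ => Finset.sum_congr rfl fun j _ => ?_
    rw [sub_eq_add_neg, fourier_add, fourier_neg, starRingEnd_apply]
    ring
  have h := congrArg (Finsupp.linearCombination ℂ t) he
  simp only [e, map_sum, Finsupp.linearCombination_single, map_zero, smul_eq_mul] at h
  rw [← h]
  simp [trace, mul_apply, ht]

section kernel

variable {N K : ℕ} {f : Fin K → UnitAddCircle} {T : Matrix (Fin N) (Fin N) ℂ}

/-- Shift invariance carries the vanishing of the form from q to Xʲq, and for a positive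
semidefinite matrix a vector of zero form lies in the kernel. -/
lemma mulVec_star_coeffVec_X_pow_mul (hpos : T.PosSemidef)
    (hT : IsToeplitz T) (h0 : nodeVec N f ⬝ᵥ (T *ᵥ star (nodeVec N f)) = 0) (j : ℕ)
    (hj : j + K < N) : T *ᵥ star (coeffVec N (X ^ j * nodePoly f)) = 0 := by
  have key : coeffVec N (X ^ j * nodePoly f) ⬝ᵥ
      (T *ᵥ star (coeffVec N (X ^ j * nodePoly f))) = 0 := by
    induction j with
    | zero => simpa [nodeVec] using h0
    | succ j ih =>
      have hdeg : (X ^ j * nodePoly f).natDegree + 1 < N := by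
        have := natDegree_mul_le (p := (X : ℂ[X]) ^ j) (q := nodePoly f)
        rw [natDegree_nodePoly, natDegree_X_pow] at this
        omega
      rw [pow_succ', mul_assoc, hT.form_X_mul hdeg hdeg]
      exact ih (by omega)
  rwa [← hpos.dotProduct_mulVec_zero_iff, star_star]

lemma mulVec_star_coeffVec_mul_nodePoly (hpos : T.PosSemidef)
    (hT : IsToeplitz T) (h0 : nodeVec N f ⬝ᵥ (T *ᵥ star (nodeVec N f)) = 0) (m : ℂ[X])
    (hm : m.natDegree + K < N) : T *ᵥ star (coeffVec N (m * nodePoly f)) = 0 := by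
  refine Polynomial.induction_with_natDegree_le
    (fun m => T *ᵥ star (coeffVec N (m * nodePoly f)) = 0) (N - K - 1) ?_ ?_ ?_ m (by omega)
  · have : coeffVec N (0 : ℂ[X]) = 0 := by ext; simp [coeffVec]
    simp [this]
  · intro j c _ hj
    rw [mul_assoc, coeffVec_C_mul, star_smul, mulVec_smul,
      mulVec_star_coeffVec_X_pow_mul hpos hT h0 j (by omega), smul_zero]
  · intro P Q _ _ hP hQ
    rw [add_mul, coeffVec_add, star_add, mulVec_add, hP, hQ, add_zero]

/-- The kernel of a positive semidefinite Toeplitz matrix annihilating the nodal polynomial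
contains all polynomials that vanish at the nodes. -/
lemma mulVec_star_coeffVec_eq_zero (hf : Function.Injective f) (hpos : T.PosSemidef)
    (hT : IsToeplitz T) (h0 : nodeVec N f ⬝ᵥ (T *ᵥ star (nodeVec N f)) = 0) {r : ℂ[X]}
    (hr : r.natDegree < N) (hroot : ∀ k, r.eval (circlePoint (f k)) = 0) :
    T *ᵥ star (coeffVec N r) = 0 := by
  have hdvd : nodePoly f ∣ r := by
    rw [nodePoly, Lagrange.nodal_eq]
    refine Finset.prod_dvd_of_coprime (fun i _ j _ hij => ?_)
      fun k _ => dvd_iff_isRoot.2 (hroot k)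
    exact pairwise_coprime_X_sub_C (s := fun k => circlePoint (f k))
      (circlePoint_injective.comp hf) hij
  obtain ⟨m, rfl⟩ := hdvd
  by_cases hm : m = 0
  · have : coeffVec N (0 : ℂ[X]) = 0 := by ext; simp [coeffVec]
    simp [hm, this]
  have hq : nodePoly f ≠ 0 := Lagrange.nodal_ne_zero
  rw [natDegree_mul hq hm, natDegree_nodePoly] at hr
  rw [mul_comm]
  exact mulVec_star_coeffVec_mul_nodePoly hpos hT h0 m (by omega)

/-- A positive semidefinite Toeplitz matrix annihilating the nodal polynomial of the
frequencies `f` is a nonnegative combination of the `a(fₖ) a(fₖ)ᴴ`. -/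
lemma IsToeplitz.exists_eq_diagonal (hKN : K < N) (hf : Function.Injective f)
    (hpos : T.PosSemidef) (hT : IsToeplitz T)
    (h0 : nodeVec N f ⬝ᵥ (T *ᵥ star (nodeVec N f)) = 0) :
    ∃ p : Fin K → ℝ, (∀ k, 0 ≤ p k) ∧
      T = vandermondeMatrix N f * diagonal (fun k => (p k : ℂ)) * (vandermondeMatrix N f)ᴴ := by
  set A := vandermondeMatrix N f with hA
  set Λ := lagrangeMatrix N f with hΛ
  have hker : ∀ {r : ℂ[X]}, r.natDegree < N → (∀ k, r.eval (circlePoint (f k)) = 0) →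
      T *ᵥ star (coeffVec N r) = 0 :=
    fun hr hroot => mulVec_star_coeffVec_eq_zero hf hpos hT h0 hr hroot
  have hdeg : ∀ k, (nodeBasis f k).natDegree + 1 < N := fun k => by
    have := k.2
    rw [natDegree_nodeBasis hf]; omega
  -- Row i of 1 − AΛ holds the coefficients of Xⁱ minus its interpolant at the nodes, a polynomial
  -- vanishing at every node.
  have hTΓ : T * (1 - A * Λ)ᴴ = 0 := by
    have hrow : ∀ i : Fin N, T *ᵥ star ((1 - A * Λ : Matrix (Fin N) (Fin N) ℂ) i) = 0 :=
        fun i => by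
      have : (1 - A * Λ : Matrix (Fin N) (Fin N) ℂ) i =
          coeffVec N (X ^ (i : ℕ) - ∑ k, C (circlePoint (f k) ^ (i : ℕ)) * nodeBasis f k) := by
        ext j
        simp only [coeffVec, coeff_sub, finsetSum_coeff, coeff_C_mul, coeff_X_pow]
        simp [coeffVec, mul_apply, hA, hΛ, vandermondeMatrix, lagrangeMatrix, sinusoid_apply,
          one_apply, Fin.ext_iff, eq_comm]
      rw [this]
      refine hker ?_ fun k => ?_
      · refine lt_of_le_of_lt (natDegree_sub_le_of_le (m := N - 1) (n := N - 1) ?_ ?_) (by omega)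
        · rw [natDegree_X_pow]; omega
        · refine natDegree_sum_le_of_forall_le _ _ fun k _ => ?_
          refine (natDegree_C_mul_le _ _).trans ?_
          have := hdeg k
          omega
      · simp [eval_finsetSum, eval_nodeBasis hf]
    ext i j
    exact congrFun (hrow j) i
  have h1 : T = T * Λᴴ * Aᴴ := by
    rw [conjTranspose_sub, conjTranspose_one, conjTranspose_mul, Matrix.mul_sub, Matrix.mul_one,
      sub_eq_zero, ← Matrix.mul_assoc] at hTΓ
    exact hTΓ
  have h2 : T = A * (Λ * T * Λᴴ) * Aᴴ := by
    have h3 := congrArg conjTranspose h1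
    rw [conjTranspose_mul, conjTranspose_mul, conjTranspose_conjTranspose,
      conjTranspose_conjTranspose, hpos.isHermitian.eq] at h3
    conv_lhs => rw [h1, h3]
    simp only [Matrix.mul_assoc]
  have hP : (Λ * T * Λᴴ).PosSemidef := hpos.mul_mul_conjTranspose_same Λ
  have hentry : ∀ j k, (Λ * T * Λᴴ) j k =
      coeffVec N (nodeBasis f j) ⬝ᵥ (T *ᵥ star (coeffVec N (nodeBasis f k))) := fun j k => by
    rw [Matrix.mul_assoc]
    rfl
  -- The polynomial (X − z_k)ℓ_k vanishes at all nodes, so modulo the kernel X acts on ℓ_k as the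
  -- scalar z_k.
  have hX : ∀ k, T *ᵥ star (coeffVec N (X * nodeBasis f k)) =
      star (circlePoint (f k)) • (T *ᵥ star (coeffVec N (nodeBasis f k))) := fun k => by
    have hsplit : X * nodeBasis f k =
        (X - C (circlePoint (f k))) * nodeBasis f k + C (circlePoint (f k)) * nodeBasis f k := by
      ring
    rw [hsplit, coeffVec_add, star_add, mulVec_add, hker, zero_add, coeffVec_C_mul, star_smul,
      mulVec_smul]
    · refine lt_of_le_of_lt natDegree_mul_le ?_
      rw [natDegree_X_sub_C, add_comm]
      exact hdeg k
    · intro j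
      rw [eval_mul, eval_nodeBasis hf]
      split_ifs with h
      · simp [h]
      · simp
  have hsymm : ∀ v w : Fin N → ℂ, v ⬝ᵥ (T *ᵥ star w) = star (w ⬝ᵥ (T *ᵥ star v)) := by
    intro v w
    rw [dotProduct_mulVec v, dotProduct_star, star_vecMul, hpos.isHermitian.eq]
  -- Shift invariance multiplies the (j, k) entry by z_j z_k⁻¹ without changing it, and this factor
  -- is not 1 for distinct nodes.
  have hoff : ∀ j k, j ≠ k → (Λ * T * Λᴴ) j k = 0 := fun j k hjk => by
    have h3 := hT.form_X_mul (hdeg j) (hdeg k)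
    rw [hX, dotProduct_smul, hsymm, hX, dotProduct_smul, star_smul, ← hsymm, star_star,
      ← hentry, smul_eq_mul, smul_eq_mul, star_circlePoint] at h3
    by_contra hne
    have h4 : (circlePoint (f k))⁻¹ * circlePoint (f j) = 1 :=
      mul_right_cancel₀ hne (by rw [mul_assoc, h3, one_mul])
    rw [inv_mul_eq_one₀ (circlePoint_ne_zero _)] at h4
    exact hjk (hf (circlePoint_injective h4)).symm
  refine ⟨fun k => ((Λ * T * Λᴴ) k k).re, fun k => (Complex.nonneg_iff.1 hP.diag_nonneg).1, ?_⟩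
  convert h2 using 3
  ext j k
  by_cases hjk : j = k
  · subst hjk
    rw [diagonal_apply_eq]
    exact (Complex.ext rfl (by simpa using (Complex.nonneg_iff.1 (hP.diag_nonneg (i := j))).2))
  · rw [diagonal_apply_ne _ hjk, hoff j k hjk]

end kernel

end WAN

/-! ### Quadratic form estimates, and the reduction of Lagrange forms to |q|². -/

namespace WAN

section quadratic

lemma star_dotProduct_self {n : Type*} [Fintype n] (x : n → ℂ) :
    star x ⬝ᵥ x = ((∑ i, ‖x i‖ ^ 2 : ℝ) : ℂ) := by
  simp [dotProduct, Complex.conj_mul']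

lemma norm_dotProduct_sq_le {n : Type*} [Fintype n] (v x : n → ℂ) :
    ‖v ⬝ᵥ x‖ ^ 2 ≤ (∑ i, ‖v i‖ ^ 2) * ∑ i, ‖x i‖ ^ 2 := by
  refine le_trans ?_ (Finset.sum_mul_sq_le_sq_mul_sq Finset.univ (fun i => ‖v i‖) fun i => ‖x i‖)
  gcongr
  exact (norm_sum_le _ _).trans (by simp)

lemma sum_norm_mulVec_sq_le {m n : Type*} [Fintype m] [Fintype n] (B : Matrix m n ℂ)
    (x : n → ℂ) :
    ∑ i, ‖(B *ᵥ x) i‖ ^ 2 ≤ (∑ i, ∑ j, ‖B i j‖ ^ 2) * ∑ i, ‖x i‖ ^ 2 := by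
  rw [Finset.sum_mul]
  exact Finset.sum_le_sum fun i _ => norm_dotProduct_sq_le (B i) x

lemma star_dotProduct_vecMulVec_mulVec {n : Type*} [Fintype n] (u v x : n → ℂ) :
    star x ⬝ᵥ (vecMulVec u v *ᵥ x) = (star x ⬝ᵥ u) * (v ⬝ᵥ x) := by
  rw [vecMulVec_mulVec, op_smul_eq_smul, dotProduct_smul, smul_eq_mul, mul_comm]

lemma star_dotProduct_conjTranspose_mul_mulVec {m n : Type*} [Fintype m] [Fintype n]
    (B C : Matrix m n ℂ) (x : n → ℂ) :
    star x ⬝ᵥ ((Bᴴ * C) *ᵥ x) = star (B *ᵥ x) ⬝ᵥ (C *ᵥ x) := by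
  rw [star_mulVec, ← dotProduct_mulVec, mulVec_mulVec]

/-- A perturbation of the identity by a Gram matrix and a multiple of a rank-one matrix is
positive semidefinite if the perturbation is small. -/
lemma posSemidef_one_add_smul_sub {m n : Type*} [Fintype m] [Fintype n] [DecidableEq n]
    (B : Matrix m n ℂ) (v : n → ℂ) (c : ℝ)
    (h : (∑ i, ∑ j, ‖B i j‖ ^ 2) + |c| * ∑ i, ‖v i‖ ^ 2 ≤ 1) :
    (1 + (c : ℂ) • vecMulVec (star v) v - Bᴴ * B).PosSemidef := by
  rw [posSemidef_iff_dotProduct_mulVec]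
  constructor
  · have h1 : (vecMulVec (star v) v).IsHermitian := by
      simp [IsHermitian, conjTranspose_vecMulVec]
    have h2 : ((c : ℂ) • vecMulVec (star v) v).IsHermitian := by
      rw [IsHermitian, conjTranspose_smul, h1.eq]
      simp
    exact (isHermitian_one.add h2).sub (isHermitian_conjTranspose_mul_self B)
  · intro x
    have e : star x ⬝ᵥ ((1 + (c : ℂ) • vecMulVec (star v) v - Bᴴ * B) *ᵥ x) =
        (((∑ i, ‖x i‖ ^ 2) + c * ‖v ⬝ᵥ x‖ ^ 2 - ∑ i, ‖(B *ᵥ x) i‖ ^ 2 : ℝ) : ℂ) := by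
      rw [sub_mulVec, add_mulVec, one_mulVec, smul_mulVec, dotProduct_sub, dotProduct_add,
        dotProduct_smul, star_dotProduct_vecMulVec_mulVec,
        star_dotProduct_conjTranspose_mul_mulVec, star_dotProduct_self, star_dotProduct_self,
        star_dotProduct_star, smul_eq_mul]
      have : star (v ⬝ᵥ x) * (v ⬝ᵥ x) = ((‖v ⬝ᵥ x‖ ^ 2 : ℝ) : ℂ) := by
        simp [Complex.conj_mul']
      rw [this]
      push_cast
      ring
    rw [e]
    norm_cast
    have h1 := sum_norm_mulVec_sq_le B x
    have h2 := norm_dotProduct_sq_le v x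
    have h3 : -(|c| * ‖v ⬝ᵥ x‖ ^ 2) ≤ c * ‖v ⬝ᵥ x‖ ^ 2 := by
      have := mul_le_mul_of_nonneg_right (neg_abs_le c) (sq_nonneg ‖v ⬝ᵥ x‖)
      linarith
    have h4 := mul_le_mul_of_nonneg_left h2 (abs_nonneg c)
    have h5 : 0 ≤ ∑ i, ‖x i‖ ^ 2 := Finset.sum_nonneg fun i _ => sq_nonneg _
    nlinarith [mul_le_mul_of_nonneg_right h h5]

end quadratic

section identity

variable {N K : ℕ} (f : Fin K → UnitAddCircle) (J : Matrix (Fin K) (Fin K) ℂ)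

/-- The coefficients of the nodal polynomial in the first-order correction of the form `J` of the
Lagrange polynomials. -/
noncomputable def formCorrection : Fin K → ℂ := fun k => ∑ j, J k j * nodeCorrection f j k

/-- The multiple of `|q|²` to which the corrected form `J` of the Lagrange polynomials reduces. -/
noncomputable def formRatio : ℝ := (∑ j, ∑ k, J j k * nodeRatio f j k).re

variable {f J}

/-- A Hermitian form with zero diagonal in the Lagrange polynomials reduces, after a first-order
correction by the nodal polynomial `q`, to a multiple of `|q|²`. -/
lemma form_nodeBasis_eq (hKN : K < N) (hf : Function.Injective f) (hJ : J.IsHermitian)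
    (hJ0 : ∀ k, J k k = 0) (g : UnitAddCircle) :
    star (sinusoid N g) ⬝ᵥ (((lagrangeMatrix N f)ᴴ * J * lagrangeMatrix N f
      - (lagrangeMatrix N f)ᴴ * vecMulVec (formCorrection f J) (nodeVec N f)
      - (vecMulVec (formCorrection f J) (nodeVec N f))ᴴ * lagrangeMatrix N f
      - (formRatio f J : ℂ) • vecMulVec (star (nodeVec N f)) (nodeVec N f)) *ᵥ sinusoid N g)
      = 0 := by
  set ℓ := lagrangeMatrix N f *ᵥ sinusoid N g with hℓ
  set q := nodeVec N f ⬝ᵥ sinusoid N g with hq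
  have hlag : ∀ k, ℓ k = (nodeBasis f k).eval (circlePoint g) :=
    lagrangeMatrix_mulVec_sinusoid hKN hf g
  have hnode : q = (nodePoly f).eval (circlePoint g) := nodeVec_dotProduct_sinusoid hKN g
  have h1 : star ℓ ⬝ᵥ (J *ᵥ ℓ) = ∑ j, ∑ k, J j k * (star (ℓ j) * ℓ k) := by
    simp only [dotProduct, mulVec, Finset.mul_sum, Pi.star_apply]
    exact Finset.sum_congr rfl fun j _ => Finset.sum_congr rfl fun k _ => by ring
  have h2 : (star ℓ ⬝ᵥ formCorrection f J) * q =
      ∑ j, ∑ k, J j k * (nodeCorrection f k j * star (ℓ j) * q) := by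
    simp only [dotProduct, formCorrection, Finset.mul_sum, Finset.sum_mul, Pi.star_apply]
    exact Finset.sum_congr rfl fun j _ => Finset.sum_congr rfl fun k _ => by ring
  have h3 : star ((star ℓ ⬝ᵥ formCorrection f J) * q) =
      ∑ j, ∑ k, J j k * (star (nodeCorrection f j k) * ℓ k * star q) := by
    rw [h2]
    simp only [star_sum]
    rw [Finset.sum_comm]
    refine Finset.sum_congr rfl fun j _ => Finset.sum_congr rfl fun k _ => ?_
    rw [← hJ.apply j k]
    simp only [star_mul', star_star]
  have key : star ℓ ⬝ᵥ (J *ᵥ ℓ) - (star ℓ ⬝ᵥ formCorrection f J) * q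
      - star ((star ℓ ⬝ᵥ formCorrection f J) * q) =
      (∑ j, ∑ k, J j k * nodeRatio f j k) * (star q * q) := by
    rw [h3, h1, h2]
    simp only [← Finset.sum_sub_distrib, Finset.sum_mul]
    refine Finset.sum_congr rfl fun j _ => Finset.sum_congr rfl fun k _ => ?_
    by_cases hjk : j = k
    · subst hjk
      simp [hJ0]
    · rw [mul_assoc (J j k) (nodeRatio f j k), hlag, hlag, hnode,
        ← star_eval_nodeBasis_mul hf hjk]
      ring
  have hqq : star q * q = ((‖q‖ ^ 2 : ℝ) : ℂ) := by simp [Complex.conj_mul']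
  have hreal : (star ℓ ⬝ᵥ (J *ᵥ ℓ)).im = 0 := by
    have := hJ.im_star_dotProduct_mulVec_self ℓ
    simpa using this
  -- The left side is real, as J is Hermitian and the two corrections are conjugate; so the complex
  -- ratio in `key` may be replaced by its real part.
  have key' : star ℓ ⬝ᵥ (J *ᵥ ℓ) - (star ℓ ⬝ᵥ formCorrection f J) * q
      - star ((star ℓ ⬝ᵥ formCorrection f J) * q) = (formRatio f J : ℂ) * (star q * q) := by
    apply Complex.ext
    · rw [key, hqq, Complex.re_mul_ofReal, ← Complex.ofReal_mul, Complex.ofReal_re, formRatio]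
    · rw [hqq, ← Complex.ofReal_mul, Complex.ofReal_im]
      simp only [Complex.sub_im, hreal, Complex.star_def, Complex.conj_im]
      ring
  have e1 : star (sinusoid N g) ⬝ᵥ (((lagrangeMatrix N f)ᴴ * J * lagrangeMatrix N f) *ᵥ
      sinusoid N g) = star ℓ ⬝ᵥ (J *ᵥ ℓ) := by
    rw [Matrix.mul_assoc, star_dotProduct_conjTranspose_mul_mulVec, ← mulVec_mulVec]
  have e2 : star (sinusoid N g) ⬝ᵥ (((lagrangeMatrix N f)ᴴ *
      vecMulVec (formCorrection f J) (nodeVec N f)) *ᵥ sinusoid N g) =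
      (star ℓ ⬝ᵥ formCorrection f J) * q := by
    rw [star_dotProduct_conjTranspose_mul_mulVec, vecMulVec_mulVec, op_smul_eq_smul,
      dotProduct_smul, smul_eq_mul, mul_comm]
  have e3 : star (sinusoid N g) ⬝ᵥ (((vecMulVec (formCorrection f J) (nodeVec N f))ᴴ *
      lagrangeMatrix N f) *ᵥ sinusoid N g) = star ((star ℓ ⬝ᵥ formCorrection f J) * q) := by
    rw [star_dotProduct_conjTranspose_mul_mulVec, vecMulVec_mulVec, op_smul_eq_smul, star_smul,
      smul_dotProduct, smul_eq_mul, star_mul', mul_comm, star_dotProduct (formCorrection f J)]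
  have e4 : star (sinusoid N g) ⬝ᵥ (((formRatio f J : ℂ) •
      vecMulVec (star (nodeVec N f)) (nodeVec N f)) *ᵥ sinusoid N g) =
      (formRatio f J : ℂ) * (star q * q) := by
    rw [smul_mulVec, dotProduct_smul, star_dotProduct_vecMulVec_mulVec, star_dotProduct_star,
      smul_eq_mul]
  rw [sub_mulVec, sub_mulVec, sub_mulVec, dotProduct_sub, dotProduct_sub, dotProduct_sub, e1, e2,
    e3, e4, key', sub_self]

end identity

end WAN

/-! ### Orthogonal projection off the range of A, and the dual certificate. -/

namespace WAN

section trace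

variable {n : Type*} [Fintype n]

open scoped MatrixOrder in
lemma trace_mul_re_nonneg [DecidableEq n] {P T : Matrix n n ℂ} (hP : P.PosSemidef) (hT : T.PosSemidef) :
    0 ≤ (P * T).trace.re := by
  obtain ⟨C, rfl⟩ := CStarAlgebra.nonneg_iff_eq_star_mul_self.1 hT.nonneg
  rw [star_eq_conjTranspose, ← Matrix.mul_assoc, trace_mul_comm, ← Matrix.mul_assoc]
  exact (Complex.nonneg_iff.1 (hP.mul_mul_conjTranspose_same C).trace_nonneg).1

lemma trace_vecMulVec_star_mul (v : n → ℂ) (T : Matrix n n ℂ) :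
    (vecMulVec (star v) v * T).trace = v ⬝ᵥ (T *ᵥ star v) := by
  rw [vecMulVec_mul, trace_vecMulVec, dotProduct_comm, dotProduct_mulVec]

end trace

section projection

variable {N K : ℕ} {A : Matrix (Fin N) (Fin K) ℂ} {Λ : Matrix (Fin K) (Fin N) ℂ}

/-- The orthogonal projection to the orthogonal complement of the range of a matrix with linearly
independent columns. -/
noncomputable def complProj (A : Matrix (Fin N) (Fin K) ℂ) : Matrix (Fin N) (Fin N) ℂ :=
  1 - A * (Aᴴ * A)⁻¹ * Aᴴ

lemma isUnit_det_conjTranspose_mul_self (h : Λ * A = 1) : IsUnit (Aᴴ * A).det := by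
  rw [← isUnit_iff_isUnit_det]
  refine (PosDef.conjTranspose_mul_self A fun x y hxy => ?_).isUnit
  have := congrArg (Λ *ᵥ ·) hxy
  simpa [mulVec_mulVec, h] using this

lemma complProj_isHermitian (A : Matrix (Fin N) (Fin K) ℂ) : (complProj A).IsHermitian := by
  have h : ((Aᴴ * A)⁻¹)ᴴ = (Aᴴ * A)⁻¹ := (isHermitian_conjTranspose_mul_self A).inv
  simp [complProj, IsHermitian, conjTranspose_mul, h, Matrix.mul_assoc]

lemma complProj_mul (h : Λ * A = 1) : complProj A * A = 0 := by
  rw [complProj, Matrix.sub_mul, Matrix.one_mul, Matrix.mul_assoc, Matrix.mul_assoc,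
    nonsing_inv_mul _ (isUnit_det_conjTranspose_mul_self h), Matrix.mul_one, sub_self]

lemma conjTranspose_mul_complProj (h : Λ * A = 1) : Aᴴ * complProj A = 0 := by
  have := congrArg conjTranspose (complProj_mul h)
  rwa [conjTranspose_mul, (complProj_isHermitian A).eq, conjTranspose_zero] at this

lemma complProj_mul_self (h : Λ * A = 1) : complProj A * complProj A = complProj A := by
  conv_lhs => rw [complProj.eq_1 A]
  rw [Matrix.sub_mul, Matrix.one_mul, Matrix.mul_assoc _ Aᴴ]
  conv_lhs => rw [← complProj, conjTranspose_mul_complProj h, Matrix.mul_zero, sub_zero]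

lemma mul_complProj {m : Type*} {B : Matrix m (Fin N) ℂ} (hB : B * A = 0) :
    B * complProj A = B := by
  rw [complProj, Matrix.mul_sub, Matrix.mul_one, Matrix.mul_assoc A, ← Matrix.mul_assoc B, hB,
    Matrix.zero_mul, sub_zero]

lemma vecMul_complProj {v : Fin N → ℂ} (hv : v ᵥ* A = 0) : v ᵥ* complProj A = v := by
  rw [complProj, vecMul_sub, vecMul_one, Matrix.mul_assoc A, ← vecMul_vecMul, hv, zero_vecMul,
    sub_zero]

end projection

/-- The dual certificate: a matrix `Q` with `Qᴴ A = Sᴴ D` for which the pairing of `W - Q Qᴴ` with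
positive semidefinite Toeplitz matrices controls their value at the nodal polynomial. -/
lemma exists_certificate {N K L : ℕ} (hKN : K < N) {f : Fin K → UnitAddCircle}
    (hf : Function.Injective f) {W : Matrix (Fin N) (Fin N) ℂ} (hW : W.PosSemidef)
    (hWP : W * complProj (vandermondeMatrix N f) = complProj (vandermondeMatrix N f))
    {S : Matrix (Fin K) (Fin L) ℂ} {S' : Matrix (Fin L) (Fin K) ℂ} (hS : S * S' = 1)
    {d : Fin K → ℝ} (hd : ∀ k, d k ≠ 0) {J : Matrix (Fin K) (Fin K) ℂ}
    (hJ : J = (vandermondeMatrix N f)ᴴ * W * vandermondeMatrix N f -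
      diagonal (fun k => (d k : ℂ)) * (S * Sᴴ) * diagonal (fun k => (d k : ℂ)))
    (hJ0 : ∀ k, J k k = 0) {Θ : Matrix (Fin L) (Fin N) ℂ}
    (hΘ : Θ = S' * (diagonal (fun k => (d k : ℂ)⁻¹) * ((vandermondeMatrix N f)ᴴ * W) *
        (1 - vandermondeMatrix N f * lagrangeMatrix N f) +
      vecMulVec (formCorrection f (diagonal (fun k => (d k : ℂ)⁻¹) * J)) (nodeVec N f)))
    (hsmall : (∑ i, ∑ j, ‖Θ i j‖ ^ 2) + |formRatio f J| * ∑ i, ‖nodeVec N f i‖ ^ 2 ≤ 1 / 2) :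
    ∃ Q : Matrix (Fin N) (Fin L) ℂ,
      Qᴴ * vandermondeMatrix N f = Sᴴ * diagonal (fun k => (d k : ℂ)) ∧
      ∃ δ : ℝ, 0 < δ ∧ ∀ T : Matrix (Fin N) (Fin N) ℂ, T.PosSemidef → IsToeplitz T →
        δ * (nodeVec N f ⬝ᵥ (T *ᵥ star (nodeVec N f))).re ≤ ((W - Q * Qᴴ) * T).trace.re := by
  set A := vandermondeMatrix N f with hA
  set Λ := lagrangeMatrix N f with hΛ
  set q := nodeVec N f with hq
  set D : Matrix (Fin K) (Fin K) ℂ := diagonal (fun k => (d k : ℂ)) with hD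
  set D' : Matrix (Fin K) (Fin K) ℂ := diagonal (fun k => (d k : ℂ)⁻¹) with hD'
  set Γ : Matrix (Fin N) (Fin N) ℂ := 1 - A * Λ with hΓ
  set P := complProj A with hP
  set κ := formCorrection f J with hκ
  have hΛA : Λ * A = 1 := lagrangeMatrix_mul_vandermondeMatrix hKN hf
  have hqA : q ᵥ* A = 0 := nodeVec_vecMul_vandermondeMatrix hKN
  have hΓA : Γ * A = 0 := by
    rw [hΓ, Matrix.sub_mul, Matrix.one_mul, Matrix.mul_assoc, hΛA, Matrix.mul_one, sub_self]
  have hDD' : D * D' = 1 := by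
    rw [hD, hD', diagonal_mul_diagonal, ← diagonal_one]
    congr 1
    ext k
    exact mul_inv_cancel₀ (Complex.ofReal_ne_zero.2 (hd k))
  have hDH : Dᴴ = D := by
    rw [hD, diagonal_conjTranspose]
    congr 1
    ext k
    simp
  have hJH : J.IsHermitian := by
    rw [hJ]
    refine IsHermitian.sub ?_ ?_
    · simp [IsHermitian, conjTranspose_mul, hW.isHermitian.eq, Matrix.mul_assoc]
    · simp [IsHermitian, conjTranspose_mul, hDH, Matrix.mul_assoc]
  have hκ' : vecMulVec (formCorrection f (D' * J)) q = D' * vecMulVec κ q := by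
    rw [mul_vecMulVec]
    congr 1
    ext k
    rw [hD', mulVec_diagonal]
    simp only [formCorrection, diagonal_mul, hκ, Finset.mul_sum, mul_assoc]
  -- The first term matches the cross term of W in `hWexp`, so the two cancel in W − QQᴴ; the second
  -- is the first-order correction that J needs.
  have hDSΘ : D * S * Θ = Aᴴ * W * Γ + vecMulVec κ q := by
    rw [hΘ, hκ', Matrix.mul_assoc D', ← Matrix.mul_add, Matrix.mul_assoc D,
      ← Matrix.mul_assoc S, hS, Matrix.one_mul, ← Matrix.mul_assoc D, hDD', Matrix.one_mul]
  have hΘA : Θ * A = 0 := by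
    rw [hΘ, Matrix.mul_assoc, Matrix.add_mul, Matrix.mul_assoc _ Γ, hΓA, Matrix.mul_zero,
      vecMulVec_mul, hqA, vecMulVec_zero, zero_add, Matrix.mul_zero]
  set Q : Matrix (Fin N) (Fin L) ℂ := (Sᴴ * D * Λ + Θ)ᴴ with hQ
  -- This δ satisfies δ‖q‖² ≤ 1/2, which fits in the half left free by `hsmall`; the `+ 1` keeps the
  -- denominator positive without knowing q ≠ 0.
  refine ⟨Q, ?_, 1 / (2 * ((∑ i, ‖q i‖ ^ 2) + 1)), ?_, fun T hT hTo => ?_⟩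
  · rw [hQ, conjTranspose_conjTranspose, Matrix.add_mul, hΘA, Matrix.mul_assoc, hΛA,
      Matrix.mul_one, add_zero]
  · have : 0 ≤ ∑ i, ‖q i‖ ^ 2 := Finset.sum_nonneg fun i _ => sq_nonneg _
    positivity
  set δ : ℝ := 1 / (2 * ((∑ i, ‖q i‖ ^ 2) + 1)) with hδ
  set c : ℝ := formRatio f J with hc
  have hQQ : Q * Qᴴ = Λᴴ * (D * (S * Sᴴ) * D) * Λ + Λᴴ * (D * S * Θ) + (D * S * Θ)ᴴ * Λ +
      Θᴴ * Θ := by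
    simp only [hQ, conjTranspose_add, conjTranspose_mul, conjTranspose_conjTranspose, hDH,
      Matrix.add_mul, Matrix.mul_add, Matrix.mul_assoc]
    abel
  have hWexp : W = Λᴴ * (Aᴴ * W * A) * Λ + Λᴴ * (Aᴴ * W * Γ) + (Aᴴ * W * Γ)ᴴ * Λ + Γᴴ * W * Γ := by
    have h1 : A * Λ + Γ = 1 := by rw [hΓ]; abel
    have h2 : W = (A * Λ + Γ)ᴴ * W * (A * Λ + Γ) := by
      rw [h1, conjTranspose_one, Matrix.one_mul, Matrix.mul_one]
    conv_lhs => rw [h2]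
    simp only [conjTranspose_add, conjTranspose_mul, conjTranspose_conjTranspose,
      hW.isHermitian.eq, Matrix.add_mul, Matrix.mul_add, Matrix.mul_assoc]
    abel
  -- E collects the indefinite part of W − QQᴴ. It need not vanish, but its form is zero on every
  -- sinusoid, so it is invisible to Toeplitz matrices.
  set E := Λᴴ * J * Λ - Λᴴ * vecMulVec κ q - (vecMulVec κ q)ᴴ * Λ
    - (c : ℂ) • vecMulVec (star q) q with hE
  have hM : W - Q * Qᴴ = E + (Γᴴ * W * Γ + (c : ℂ) • vecMulVec (star q) q - Θᴴ * Θ) := by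
    rw [hQQ, hDSΘ, hE, hJ]
    nth_rewrite 1 [hWexp]
    simp only [conjTranspose_add, Matrix.add_mul, Matrix.mul_add, Matrix.mul_sub, Matrix.sub_mul]
    abel
  have hET : (E * T).trace = 0 := hTo.trace_mul_eq_zero (form_nodeBasis_eq hKN hf hJH hJ0)
  have hPP : P * P = P := complProj_mul_self hΛA
  have hPH : Pᴴ = P := complProj_isHermitian A
  have hPΓ : P * Γ = P := by
    rw [hΓ, Matrix.mul_sub, Matrix.mul_one, ← Matrix.mul_assoc, complProj_mul hΛA,
      Matrix.zero_mul, sub_zero]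
  have hΘP : Θ * P = Θ := mul_complProj hΘA
  have hqP : q ᵥ* P = q := vecMul_complProj hqA
  have hPq : P *ᵥ star q = star q := by
    have := congrArg star hqP
    rwa [star_vecMul, hPH] at this
  have hPW : P * W = P := by
    have := congrArg conjTranspose hWP
    rwa [conjTranspose_mul, hPH, hW.isHermitian.eq] at this
  -- Since WP = PW = P, W − P equals (1 − P)W(1 − P) ≥ 0; conjugating by Γ preserves P because PΓ =
  -- P.
  have hpos1 : (Γᴴ * W * Γ - P).PosSemidef := by
    have h1 : ((1 - P)ᴴ * W * (1 - P)).PosSemidef := hW.conjTranspose_mul_mul_same _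
    have h2 : (1 - P)ᴴ * W * (1 - P) = W - P := by
      rw [conjTranspose_sub, conjTranspose_one, hPH]
      simp only [Matrix.sub_mul, Matrix.mul_sub, Matrix.one_mul, Matrix.mul_one, hPW, hWP, hPP]
      abel
    have h3 := (h2 ▸ h1).conjTranspose_mul_mul_same Γ
    have h4 : Γᴴ * P * Γ = P := by
      conv_lhs => rw [Matrix.mul_assoc, hPΓ, ← hPH, ← conjTranspose_mul, hPΓ, hPH]
    rwa [Matrix.mul_sub Γᴴ, Matrix.sub_mul _ _ Γ, h4] at h3
  -- Both Θ and q are unchanged by right multiplication with P, so this matrix is the compression by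
  -- P of a small perturbation of the identity.
  have hpos2 : (P + ((c - δ : ℝ) : ℂ) • vecMulVec (star q) q - Θᴴ * Θ).PosSemidef := by
    have hsm : (∑ i, ∑ j, ‖Θ i j‖ ^ 2) + |c - δ| * ∑ i, ‖q i‖ ^ 2 ≤ 1 := by
      have h0 : 0 ≤ ∑ i, ‖q i‖ ^ 2 := Finset.sum_nonneg fun i _ => sq_nonneg _
      have h1 : δ * ∑ i, ‖q i‖ ^ 2 ≤ 1 / 2 := by
        rw [hδ, div_mul_eq_mul_div, div_le_div_iff₀ (by positivity) (by norm_num)]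
        linarith
      have h2 : 0 ≤ δ := by positivity
      have h3 : |c - δ| ≤ |c| + δ := (abs_sub _ _).trans (by rw [abs_of_nonneg h2])
      have h4 := mul_le_mul_of_nonneg_right h3 h0
      linarith
    have h1 := (posSemidef_one_add_smul_sub Θ q (c - δ) hsm).conjTranspose_mul_mul_same P
    have h2 : Pᴴ * (Θᴴ * Θ) * P = Θᴴ * Θ := by
      rw [← Matrix.mul_assoc, ← conjTranspose_mul, Matrix.mul_assoc, hΘP]
    rw [Matrix.mul_sub, Matrix.sub_mul, h2, Matrix.mul_add, Matrix.add_mul, Matrix.mul_one, hPH,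
      hPP, Matrix.mul_smul, Matrix.smul_mul, mul_vecMulVec, hPq, vecMulVec_mul, hqP] at h1
    exact h1
  have hsum := trace_mul_re_nonneg (hpos1.add hpos2) hT
  have hfin : W - Q * Qᴴ = E + ((Γᴴ * W * Γ - P) +
      (P + ((c - δ : ℝ) : ℂ) • vecMulVec (star q) q - Θᴴ * Θ)) +
      (δ : ℂ) • vecMulVec (star q) q := by
    rw [hM, Complex.ofReal_sub, sub_smul]
    abel
  rw [hfin, Matrix.add_mul, Matrix.add_mul, trace_add, trace_add, hET, zero_add, Matrix.smul_mul,
    trace_smul, trace_vecMulVec_star_mul, Complex.add_re, smul_eq_mul, Complex.re_ofReal_mul]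
  linarith

end WAN

/-! ### Full row rank of S, and bounds on the weight matrix for small ε. -/

namespace WAN

open Filter Topology

section rank

variable {K L : ℕ} {S : Matrix (Fin K) (Fin L) ℂ}

lemma isUnit_mul_conjTranspose_of_rank_eq (hS : S.rank = K) : IsUnit (S * Sᴴ) := by
  rw [← mulVec_surjective_iff_isUnit]
  have h : (S * Sᴴ).rank = K := by rw [rank_self_mul_conjTranspose, hS]
  have h2 : LinearMap.range (S * Sᴴ).mulVecLin = ⊤ := by
    apply Submodule.eq_top_of_finrank_eq
    rw [Matrix.rank] at h
    rw [h]
    simp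
  exact LinearMap.range_eq_top.1 h2

lemma mul_rightInverse_of_rank_eq (hS : S.rank = K) : S * (Sᴴ * (S * Sᴴ)⁻¹) = 1 := by
  rw [← Matrix.mul_assoc]
  exact mul_nonsing_inv _ ((isUnit_iff_isUnit_det _).1 (isUnit_mul_conjTranspose_of_rank_eq hS))

lemma mul_conjTranspose_apply_self (S : Matrix (Fin K) (Fin L) ℂ) (k : Fin K) :
    (S * Sᴴ) k k = ((∑ l, ‖S k l‖ ^ 2 : ℝ) : ℂ) := by
  simp [mul_apply, Complex.mul_conj']

lemma sum_norm_sq_row_pos (hS : S.rank = K) (k : Fin K) : 0 < ∑ l, ‖S k l‖ ^ 2 := by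
  refine lt_of_le_of_ne (Finset.sum_nonneg fun _ _ => sq_nonneg _) fun h => ?_
  have h0 : ∀ l, S k l = 0 := fun l => by
    have := (Finset.sum_eq_zero_iff_of_nonneg fun l _ => sq_nonneg ‖S k l‖).1 h.symm l
      (Finset.mem_univ l)
    simpa using this
  have h1 := congrFun (congrFun (mul_rightInverse_of_rank_eq hS) k) k
  rw [mul_apply, one_apply_eq] at h1
  simp [h0] at h1

end rank

section weight

variable {N K L : ℕ} {ε : ℝ} (Y : Matrix (Fin N) (Fin L) ℂ)

lemma sampleCov_posSemidef : (sampleCov Y).PosSemidef :=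
  (posSemidef_self_mul_conjTranspose Y).smul (by positivity)

lemma posSemidef_inv_smul_sampleCov (hε : 0 < ε) :
    (((ε⁻¹ : ℝ) : ℂ) • sampleCov Y).PosSemidef :=
  (sampleCov_posSemidef Y).smul (by
    rw [Complex.zero_le_real]
    positivity)

lemma posDef_one_add_sampleCov (hε : 0 < ε) :
    (1 + ((ε⁻¹ : ℝ) : ℂ) • sampleCov Y).PosDef :=
  PosDef.one.add_posSemidef (posSemidef_inv_smul_sampleCov Y hε)

lemma weightMatrix_posDef (hε : 0 < ε) : (weightMatrix ε Y).PosDef :=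
  (posDef_one_add_sampleCov Y hε).inv

lemma weightMatrix_mul (hε : 0 < ε) :
    weightMatrix ε Y * (1 + ((ε⁻¹ : ℝ) : ℂ) • sampleCov Y) = 1 :=
  nonsing_inv_mul _ ((isUnit_iff_isUnit_det _).1 (posDef_one_add_sampleCov Y hε).isUnit)

lemma mul_weightMatrix (hε : 0 < ε) :
    (1 + ((ε⁻¹ : ℝ) : ℂ) • sampleCov Y) * weightMatrix ε Y = 1 :=
  mul_nonsing_inv _ ((isUnit_iff_isUnit_det _).1 (posDef_one_add_sampleCov Y hε).isUnit)

/-- This rearranged resolvent identity is the source of the factor ε in AᴴW. -/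
lemma sampleCov_mul_weightMatrix (hε : 0 < ε) :
    sampleCov Y * weightMatrix ε Y = (ε : ℂ) • (1 - weightMatrix ε Y) := by
  have h := mul_weightMatrix Y hε
  rw [Matrix.add_mul, Matrix.one_mul, Matrix.smul_mul] at h
  rw [← h, add_sub_cancel_left, smul_smul, ← Complex.ofReal_mul, mul_inv_cancel₀ hε.ne',
    Complex.ofReal_one, one_smul]

/-- From W − W² = W(ε⁻¹R̂)W ≥ 0, the squared norm of column j is at most W_jj; this bounds W_jj by 1
first, then the whole column. -/
lemma norm_weightMatrix_apply_le (hε : 0 < ε) (i j : Fin N) : ‖weightMatrix ε Y i j‖ ≤ 1 := by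
  set W := weightMatrix ε Y with hW
  have hH : Wᴴ = W := (weightMatrix_posDef Y hε).isHermitian
  have h1 : (Wᴴ * (((ε⁻¹ : ℝ) : ℂ) • sampleCov Y) * W).PosSemidef :=
    (posSemidef_inv_smul_sampleCov Y hε).conjTranspose_mul_mul_same W
  have h2 : Wᴴ * (((ε⁻¹ : ℝ) : ℂ) • sampleCov Y) * W = W - Wᴴ * W := by
    have h := mul_weightMatrix Y hε
    rw [Matrix.add_mul, Matrix.one_mul, ← hW] at h
    rw [Matrix.mul_assoc, eq_sub_of_add_eq' h, Matrix.mul_sub, Matrix.mul_one, hH]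
  rw [h2] at h1
  have h3 := (Complex.nonneg_iff.1 (h1.diag_nonneg (i := j))).1
  have h4 : (Wᴴ * W) j j = ((∑ i, ‖W i j‖ ^ 2 : ℝ) : ℂ) := by
    simp [mul_apply, Complex.conj_mul']
  rw [Matrix.sub_apply, h4, Complex.sub_re, Complex.ofReal_re, sub_nonneg] at h3
  have h5 : ∀ i, ‖W i j‖ ^ 2 ≤ ‖W j j‖ := fun i =>
    (Finset.single_le_sum (f := fun i => ‖W i j‖ ^ 2) (fun _ _ => sq_nonneg _)
      (Finset.mem_univ i)).trans (h3.trans (Complex.re_le_norm _))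
  have h6 : ‖W j j‖ ≤ 1 := by
    by_contra! hlt
    nlinarith [h5 j]
  exact (sq_le_one_iff₀ (norm_nonneg _)).1 ((h5 i).trans h6)

variable {Y} {A : Matrix (Fin N) (Fin K) ℂ} {Λ : Matrix (Fin K) (Fin N) ℂ}
  {S : Matrix (Fin K) (Fin L) ℂ}

lemma weightMatrix_mul_complProj (hΛ : Λ * A = 1) (hY : Y = A * S) (hε : 0 < ε) :
    weightMatrix ε Y * complProj A = complProj A := by
  have h0 : sampleCov Y * complProj A = 0 := by
    rw [sampleCov, hY, conjTranspose_mul, Matrix.smul_mul, Matrix.mul_assoc, Matrix.mul_assoc,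
      Matrix.mul_assoc, conjTranspose_mul_complProj hΛ]
    simp
  have h := congrArg (· * complProj A) (weightMatrix_mul Y hε)
  simpa [Matrix.mul_assoc, Matrix.add_mul, h0] using h

/-- Full row rank of S makes SSᴴ invertible, so R̂ has the same range as A. -/
lemma exists_eq_sampleCov_mul (hΛ : Λ * A = 1) (hS : S.rank = K) (hY : Y = A * S) :
    ∃ B : Matrix (Fin N) (Fin K) ℂ, A = sampleCov Y * B := by
  -- Only K > 0 forces L > 0, which is needed to cancel the factor 1/L in R̂.
  rcases Nat.eq_zero_or_pos K with hK | hK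
  · subst hK
    exact ⟨0, by ext i k; exact k.elim0⟩
  have hL : (L : ℂ) ≠ 0 := by
    have := (rank_le_width S)
    rw [Nat.cast_ne_zero]
    omega
  refine ⟨(L : ℂ) • (Λᴴ * (S * Sᴴ)⁻¹), ?_⟩
  have h1 : Aᴴ * Λᴴ = 1 := by rw [← conjTranspose_mul, hΛ, conjTranspose_one]
  have h2 : S * Sᴴ * (S * Sᴴ)⁻¹ = 1 :=
    mul_nonsing_inv _ ((isUnit_iff_isUnit_det _).1 (isUnit_mul_conjTranspose_of_rank_eq hS))
  have h3 : A * S * (A * S)ᴴ * (Λᴴ * (S * Sᴴ)⁻¹) = A := by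
    calc A * S * (A * S)ᴴ * (Λᴴ * (S * Sᴴ)⁻¹)
        = A * (S * Sᴴ * ((Aᴴ * Λᴴ) * (S * Sᴴ)⁻¹)) := by
          simp only [conjTranspose_mul, Matrix.mul_assoc]
      _ = A := by rw [h1, Matrix.one_mul, h2, Matrix.mul_one]
  rw [sampleCov, hY, Matrix.mul_smul, Matrix.smul_mul, h3, smul_smul, mul_one_div_cancel hL,
    one_smul]

lemma exists_norm_conjTranspose_mul_weightMatrix_le (hΛ : Λ * A = 1) (hS : S.rank = K)
    (hY : Y = A * S) :
    ∃ C : Fin K → ℝ, ∀ ε : ℝ, 0 < ε → ∀ k i, ‖(Aᴴ * weightMatrix ε Y) k i‖ ≤ C k * ε := by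
  obtain ⟨B, hB⟩ := exists_eq_sampleCov_mul hΛ hS hY
  refine ⟨fun k => ∑ j, ‖B j k‖ * 2, fun ε hε k i => ?_⟩
  have h1 : Aᴴ * weightMatrix ε Y = (ε : ℂ) • (Bᴴ * (1 - weightMatrix ε Y)) := by
    conv_lhs => rw [hB, conjTranspose_mul, (sampleCov_posSemidef Y).isHermitian.eq,
      Matrix.mul_assoc, sampleCov_mul_weightMatrix Y hε, Matrix.mul_smul]
  rw [h1, Matrix.smul_apply, norm_smul, Complex.norm_real, Real.norm_of_nonneg hε.le, mul_comm]
  gcongr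
  rw [mul_apply]
  refine norm_sum_le_of_le _ fun j _ => ?_
  rw [norm_mul, conjTranspose_apply, norm_star]
  gcongr
  rw [Matrix.sub_apply]
  refine (norm_sub_le _ _).trans ?_
  have h2 := norm_weightMatrix_apply_le Y hε j i
  have h3 : ‖(1 : Matrix (Fin N) (Fin N) ℂ) j i‖ ≤ 1 := by
    rw [one_apply]
    split_ifs <;> simp
  linarith

/-- With B = W⁻¹, the inequality (1 − tB)W(1 − tB) ≥ 0 reads W ≥ 2t − t²B, a lower bound for W that
avoids inverting anything. -/
lemma exists_le_conjTranspose_mul_weightMatrix_mul (hΛ : Λ * A = 1) (k : Fin K) :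
    ∃ c : ℝ, 0 < c ∧ ∀ ε : ℝ, 0 < ε → ε ≤ 1 →
      c * ε ≤ ((Aᴴ * weightMatrix ε Y * A) k k).re := by
  set g := ((Aᴴ * A) k k).re with hg
  set ρ := ((Aᴴ * sampleCov Y * A) k k).re with hρ
  have hg0 : 0 < g := by
    have h : (Aᴴ * A).PosDef := PosDef.conjTranspose_mul_self A fun x y hxy => by
      have := congrArg (Λ *ᵥ ·) hxy
      simpa [mulVec_mulVec, hΛ] using this
    exact (Complex.pos_iff.1 h.diag_pos).1
  have hρ0 : 0 ≤ ρ :=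
    (Complex.nonneg_iff.1
      ((sampleCov_posSemidef Y).conjTranspose_mul_mul_same A).diag_nonneg).1
  refine ⟨g ^ 2 / (g + ρ), by positivity, fun ε hε hε1 => ?_⟩
  set W := weightMatrix ε Y with hW
  -- On column k the lower bound is 2tg − t²(g + ρ/ε). For ε ≤ 1 this t makes the subtracted term at
  -- most tg, leaving tg, which is linear in ε.
  set t : ℝ := g / (g + ρ) * ε with ht
  set R := sampleCov Y with hR
  set B : Matrix (Fin N) (Fin N) ℂ := 1 + ((ε⁻¹ : ℝ) : ℂ) • R with hB
  have hBH : Bᴴ = B := (posDef_one_add_sampleCov Y hε).isHermitian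
  have hWB : W * B = 1 := weightMatrix_mul Y hε
  have hBW : B * W = 1 := mul_weightMatrix Y hε
  have h1 := ((weightMatrix_posDef Y hε).posSemidef.conjTranspose_mul_mul_same
    (1 - (t : ℂ) • B)).conjTranspose_mul_mul_same A
  have h2 : (1 - (t : ℂ) • B)ᴴ * W * (1 - (t : ℂ) • B) =
      W - (t : ℂ) • 1 - (t : ℂ) • 1 + ((t * t : ℝ) : ℂ) • B := by
    rw [conjTranspose_sub, conjTranspose_one, conjTranspose_smul, hBH, Complex.star_def,
      Complex.conj_ofReal]
    simp only [Matrix.sub_mul, Matrix.mul_sub, Matrix.one_mul, Matrix.mul_one, Matrix.smul_mul,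
      Matrix.mul_smul, hWB, hBW, smul_sub, smul_smul, Complex.ofReal_mul]
    abel
  rw [← hW, h2] at h1
  have h3 := (Complex.nonneg_iff.1 (h1.diag_nonneg (i := k))).1
  rw [hB] at h3
  simp only [Matrix.sub_mul, Matrix.mul_sub, Matrix.add_mul, Matrix.mul_add, Matrix.mul_one,
    Matrix.smul_mul, Matrix.mul_smul, Matrix.sub_apply, Matrix.add_apply, Matrix.smul_apply,
    smul_eq_mul, smul_add, Complex.add_re, Complex.sub_re, Complex.re_ofReal_mul, ← hg,
    ← hρ] at h3
  have h4 : t * t * (ε⁻¹ * ρ) + t * t * g ≤ g / (g + ρ) * g * ε := by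
    have e1 : t * t * (ε⁻¹ * ρ) = (g / (g + ρ)) ^ 2 * ρ * ε := by
      rw [ht]; field_simp
    have e2 : t * t * g ≤ (g / (g + ρ)) ^ 2 * g * ε := by
      rw [ht]
      have : 0 ≤ (g / (g + ρ)) ^ 2 * g * ε * (1 - ε) := by
        have := sub_nonneg.2 hε1
        positivity
      nlinarith
    have e3 : (g / (g + ρ)) ^ 2 * ρ * ε + (g / (g + ρ)) ^ 2 * g * ε = g / (g + ρ) * g * ε := by
      field_simp
      ring
    linarith
  have h5 : g ^ 2 / (g + ρ) * ε = t * g := by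
    rw [ht]; field_simp
  have h6 : g / (g + ρ) * g * ε = t * g := by
    rw [ht]; ring
  linarith

end weight

end WAN

/-! ### Limits as ε → 0, and existence of the certificate. -/

namespace WAN

open Filter Topology

/-- The ratio of the weight of the `k`-th column of `A` to the norm of the `k`-th row of `S`. -/
noncomputable def weightRatio {N K L : ℕ} (W : Matrix (Fin N) (Fin N) ℂ)
    (A : Matrix (Fin N) (Fin K) ℂ) (S : Matrix (Fin K) (Fin L) ℂ) (k : Fin K) : ℝ :=
  Real.sqrt ((Aᴴ * W * A) k k).re / Real.sqrt (∑ l, ‖S k l‖ ^ 2)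

section asymptotics

variable {N K L : ℕ} {Y : Matrix (Fin N) (Fin L) ℂ} {A : Matrix (Fin N) (Fin K) ℂ}
  {Λ : Matrix (Fin K) (Fin N) ℂ} {S : Matrix (Fin K) (Fin L) ℂ}

lemma tendsto_matrix_iff {α m n : Type*} {l : Filter α} {F : α → Matrix m n ℂ}
    {M : Matrix m n ℂ} :
    Tendsto F l (𝓝 M) ↔ ∀ i j, Tendsto (fun a => F a i j) l (𝓝 (M i j)) :=
  tendsto_pi_nhds.trans (forall_congr' fun _ => tendsto_pi_nhds)

lemma tendsto_conjTranspose_mul_weightMatrix (hΛ : Λ * A = 1) (hS : S.rank = K)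
    (hY : Y = A * S) :
    Tendsto (fun ε : ℝ => Aᴴ * weightMatrix ε Y) (𝓝[>] 0) (𝓝 0) := by
  obtain ⟨C, hC⟩ := exists_norm_conjTranspose_mul_weightMatrix_le hΛ hS hY
  refine tendsto_matrix_iff.2 fun k i => squeeze_zero_norm' (a := fun ε => C k * ε) ?_ ?_
  · filter_upwards [self_mem_nhdsWithin] with ε hε using hC ε hε k i
  · have : Tendsto (fun ε : ℝ => C k * ε) (𝓝 0) (𝓝 (C k * 0)) :=
      tendsto_const_nhds.mul tendsto_id
    rw [mul_zero] at this
    exact this.mono_left nhdsWithin_le_nhds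

lemma tendsto_weightRatio (hΛ : Λ * A = 1) (hS : S.rank = K) (hY : Y = A * S) (k : Fin K) :
    Tendsto (fun ε : ℝ => weightRatio (weightMatrix ε Y) A S k) (𝓝[>] 0) (𝓝 0) := by
  have hc : Continuous fun M : Matrix (Fin K) (Fin N) ℂ =>
      Real.sqrt ((M * A) k k).re / Real.sqrt (∑ l, ‖S k l‖ ^ 2) := by
    refine Continuous.div_const (Real.continuous_sqrt.comp (Complex.continuous_re.comp ?_)) _
    exact (continuous_id.matrix_mul continuous_const).matrix_elem k k
  have h := (hc.tendsto 0).comp (tendsto_conjTranspose_mul_weightMatrix hΛ hS hY)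
  simpa [weightRatio, Function.comp_def] using h

lemma weightRatio_pos (hΛ : Λ * A = 1) (hS : S.rank = K) {ε : ℝ} (hε : 0 < ε) (k : Fin K) :
    0 < weightRatio (weightMatrix ε Y) A S k := by
  have h : (Aᴴ * weightMatrix ε Y * A).PosDef :=
    (weightMatrix_posDef Y hε).conjTranspose_mul_mul_same fun x y hxy => by
      have := congrArg (Λ *ᵥ ·) hxy
      simpa [mulVec_mulVec, hΛ] using this
  exact div_pos (Real.sqrt_pos.2 (Complex.pos_iff.1 h.diag_pos).1)
    (Real.sqrt_pos.2 (sum_norm_sq_row_pos hS k))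

/-- The rows of AᴴW are O(ε) and d_k is at least of order √ε, so the quotient is O(√ε). -/
lemma tendsto_inv_weightRatio_mul (hΛ : Λ * A = 1) (hS : S.rank = K) (hY : Y = A * S) :
    Tendsto (fun ε : ℝ => diagonal (fun k => (weightRatio (weightMatrix ε Y) A S k : ℂ)⁻¹) *
      (Aᴴ * weightMatrix ε Y)) (𝓝[>] 0) (𝓝 0) := by
  obtain ⟨C, hC⟩ := exists_norm_conjTranspose_mul_weightMatrix_le hΛ hS hY
  refine tendsto_matrix_iff.2 fun k i => ?_
  obtain ⟨c, hc0, hc⟩ := exists_le_conjTranspose_mul_weightMatrix_mul (Y := Y) hΛ k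
  set σ := Real.sqrt (∑ l, ‖S k l‖ ^ 2) with hσ
  have hσ0 : 0 < σ := Real.sqrt_pos.2 (sum_norm_sq_row_pos hS k)
  refine squeeze_zero_norm' (a := fun ε => σ / Real.sqrt c * C k * Real.sqrt ε) ?_ ?_
  · filter_upwards [Ioc_mem_nhdsGT (zero_lt_one' ℝ)] with ε hε
    rw [diagonal_mul, norm_mul, norm_inv, Complex.norm_real,
      Real.norm_of_nonneg (weightRatio_pos hΛ hS hε.1 k).le]
    have h1 : Real.sqrt c * Real.sqrt ε ≤ Real.sqrt ((Aᴴ * weightMatrix ε Y * A) k k).re := by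
      rw [← Real.sqrt_mul hc0.le]
      exact Real.sqrt_le_sqrt (hc ε hε.1 hε.2)
    have hsc : 0 < Real.sqrt c := Real.sqrt_pos.2 hc0
    have hse : 0 < Real.sqrt ε := Real.sqrt_pos.2 hε.1
    calc (weightRatio (weightMatrix ε Y) A S k)⁻¹ * ‖(Aᴴ * weightMatrix ε Y) k i‖
        ≤ (Real.sqrt c * Real.sqrt ε / σ)⁻¹ * (C k * ε) := by
          gcongr
          · exact div_le_div_of_nonneg_right h1 hσ0.le
          · exact hC ε hε.1 k i
      _ = σ / Real.sqrt c * C k * Real.sqrt ε := by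
          nth_rewrite 2 [← Real.mul_self_sqrt hε.1.le]
          field_simp
  · have : Tendsto (fun ε : ℝ => σ / Real.sqrt c * C k * Real.sqrt ε) (𝓝 0)
        (𝓝 (σ / Real.sqrt c * C k * Real.sqrt 0)) :=
      tendsto_const_nhds.mul (Real.continuous_sqrt.tendsto 0)
    rw [Real.sqrt_zero, mul_zero] at this
    exact this.mono_left nhdsWithin_le_nhds

end asymptotics

section certificate

variable {N K L : ℕ} {f : Fin K → UnitAddCircle} {S : Matrix (Fin K) (Fin L) ℂ}
  {Y : Matrix (Fin N) (Fin L) ℂ}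

lemma continuous_formCorrection (f : Fin K → UnitAddCircle) : Continuous (formCorrection f) :=
  continuous_pi fun k => continuous_finsetSum _ fun j _ =>
    (continuous_id.matrix_elem k j).mul continuous_const

lemma continuous_formRatio (f : Fin K → UnitAddCircle) : Continuous (formRatio f) :=
  Complex.continuous_re.comp <| continuous_finsetSum _ fun j _ => continuous_finsetSum _
    fun k _ => (continuous_id.matrix_elem j k).mul continuous_const

/-- For small `ε`, there is a dual certificate for the weight matrix `W_ε`. -/
lemma exists_certificate_weightMatrix (hKN : K < N) (hf : Function.Injective f)
    (hS : S.rank = K) (hY : Y = vandermondeMatrix N f * S) :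
    ∃ ε₀ : ℝ, 0 < ε₀ ∧ ∀ ε : ℝ, 0 < ε → ε ≤ ε₀ → ∃ Q : Matrix (Fin N) (Fin L) ℂ,
      Qᴴ * vandermondeMatrix N f = Sᴴ * diagonal (fun k =>
        (weightRatio (weightMatrix ε Y) (vandermondeMatrix N f) S k : ℂ)) ∧
      ∃ δ : ℝ, 0 < δ ∧ ∀ T : Matrix (Fin N) (Fin N) ℂ, T.PosSemidef → IsToeplitz T →
        δ * (nodeVec N f ⬝ᵥ (T *ᵥ star (nodeVec N f))).re ≤
          ((weightMatrix ε Y - Q * Qᴴ) * T).trace.re := by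
  set A := vandermondeMatrix N f with hA
  have hΛ : lagrangeMatrix N f * A = 1 := lagrangeMatrix_mul_vandermondeMatrix hKN hf
  let W : ℝ → Matrix (Fin N) (Fin N) ℂ := fun ε => weightMatrix ε Y
  let d : ℝ → Fin K → ℝ := fun ε => weightRatio (W ε) A S
  let D : ℝ → Matrix (Fin K) (Fin K) ℂ := fun ε => diagonal fun k => (d ε k : ℂ)
  let D' : ℝ → Matrix (Fin K) (Fin K) ℂ := fun ε => diagonal fun k => (d ε k : ℂ)⁻¹
  let J : ℝ → Matrix (Fin K) (Fin K) ℂ := fun ε => Aᴴ * W ε * A - D ε * (S * Sᴴ) * D ε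
  have hd : ∀ ε, 0 < ε → ∀ k, d ε k ≠ 0 := fun ε hε k => (weightRatio_pos hΛ hS hε k).ne'
  have hB : Tendsto (fun ε => Aᴴ * W ε) (𝓝[>] 0) (𝓝 0) :=
    tendsto_conjTranspose_mul_weightMatrix hΛ hS hY
  have hDB : Tendsto (fun ε => D' ε * (Aᴴ * W ε)) (𝓝[>] 0) (𝓝 0) :=
    tendsto_inv_weightRatio_mul hΛ hS hY
  have hD : Tendsto D (𝓝[>] 0) (𝓝 0) := by
    refine tendsto_matrix_iff.2 fun i j => ?_
    by_cases hij : i = j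
    · subst hij
      have h := (Complex.continuous_ofReal.tendsto 0).comp (tendsto_weightRatio hΛ hS hY i)
      simpa [D, d, W, Function.comp_def] using h
    · simp [D, hij]
  have hJ : Tendsto J (𝓝[>] 0) (𝓝 0) := by
    have hc : Continuous fun p : Matrix (Fin K) (Fin N) ℂ × Matrix (Fin K) (Fin K) ℂ =>
        p.1 * A - p.2 * (S * Sᴴ) * p.2 := by fun_prop
    have h := (hc.tendsto (0, 0)).comp (hB.prodMk_nhds hD)
    simpa [J, Function.comp_def] using h
  -- Although D⁻¹ blows up, D⁻¹J = (D⁻¹AᴴW)A − SSᴴD: the left factor D in J cancels it.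
  have hDJ : Tendsto (fun ε => D' ε * J ε) (𝓝[>] 0) (𝓝 0) := by
    have hc : Continuous fun p : Matrix (Fin K) (Fin N) ℂ × Matrix (Fin K) (Fin K) ℂ =>
        p.1 * A - (S * Sᴴ) * p.2 := by fun_prop
    have h := (hc.tendsto (0, 0)).comp (hDB.prodMk_nhds hD)
    simp only [Function.comp_def, Matrix.zero_mul, Matrix.mul_zero, sub_zero] at h
    refine h.congr' ?_
    filter_upwards [self_mem_nhdsWithin] with ε hε
    have hinv : D' ε * D ε = 1 := by
      simp only [D, D']
      rw [diagonal_mul_diagonal, ← diagonal_one]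
      congr 1
      ext k
      exact inv_mul_cancel₀ (Complex.ofReal_ne_zero.2 (hd ε hε k))
    simp only [J, Matrix.mul_sub, ← Matrix.mul_assoc, hinv, Matrix.one_mul]
  let Θ : ℝ → Matrix (Fin L) (Fin N) ℂ := fun ε => (Sᴴ * (S * Sᴴ)⁻¹) *
    (D' ε * (Aᴴ * W ε) * (1 - A * lagrangeMatrix N f) +
      vecMulVec (formCorrection f (D' ε * J ε)) (nodeVec N f))
  have hΘ : Tendsto Θ (𝓝[>] 0) (𝓝 0) := by
    have hc : Continuous fun p : Matrix (Fin K) (Fin N) ℂ × Matrix (Fin K) (Fin K) ℂ =>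
        (Sᴴ * (S * Sᴴ)⁻¹) * (p.1 * (1 - A * lagrangeMatrix N f) +
          vecMulVec (formCorrection f p.2) (nodeVec N f)) := by
      refine continuous_const.matrix_mul ((continuous_fst.matrix_mul continuous_const).add ?_)
      exact ((continuous_formCorrection f).comp continuous_snd).matrix_vecMulVec continuous_const
    have h := (hc.tendsto (0, 0)).comp (hDB.prodMk_nhds hDJ)
    have h0 : formCorrection f (0 : Matrix (Fin K) (Fin K) ℂ) = 0 := by
      ext k; simp [formCorrection]
    simpa [h0, Θ, Function.comp_def] using h
  have hlim : Tendsto (fun ε => (∑ i, ∑ j, ‖Θ ε i j‖ ^ 2) +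
      |formRatio f (J ε)| * ∑ i, ‖nodeVec N f i‖ ^ 2) (𝓝[>] 0) (𝓝 0) := by
    have hc : Continuous fun p : Matrix (Fin L) (Fin N) ℂ × Matrix (Fin K) (Fin K) ℂ =>
        (∑ i, ∑ j, ‖p.1 i j‖ ^ 2) + |formRatio f p.2| * ∑ i, ‖nodeVec N f i‖ ^ 2 := by
      refine Continuous.add (continuous_finsetSum _ fun i _ => continuous_finsetSum _ fun j _ =>
        ((continuous_fst.matrix_elem i j).norm.pow 2)) ?_
      exact ((continuous_formRatio f).comp continuous_snd).abs.mul continuous_const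
    have h := (hc.tendsto (0, 0)).comp (hΘ.prodMk_nhds hJ)
    have h0 : formRatio f (0 : Matrix (Fin K) (Fin K) ℂ) = 0 := by simp [formRatio]
    simpa [h0, Function.comp_def] using h
  have hev := hlim.eventually (gt_mem_nhds (show (0 : ℝ) < 1 / 2 by norm_num))
  obtain ⟨ε₀, hε₀, hsub⟩ := mem_nhdsGT_iff_exists_Ioc_subset.1 hev
  refine ⟨ε₀, hε₀, fun ε hε hle => ?_⟩
  refine exists_certificate hKN hf (weightMatrix_posDef Y hε).posSemidef
    (weightMatrix_mul_complProj hΛ hY hε) (mul_rightInverse_of_rank_eq hS) (hd ε hε)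
    (J := J ε) rfl (fun k => ?_) (Θ := Θ ε) rfl (le_of_lt (hsub ⟨hε, hle⟩))
  have h1 := ((weightMatrix_posDef Y hε).posSemidef.conjTranspose_mul_mul_same A).diag_nonneg
    (i := k)
  have h2 : (Aᴴ * W ε * A) k k = (((Aᴴ * W ε * A) k k).re : ℂ) :=
    Complex.ext rfl (Complex.nonneg_iff.1 h1).2.symm
  -- This normalisation d_k²‖S_k‖² = w(f_k)² is what makes the diagonal of J vanish.
  have h3 : d ε k * (∑ l, ‖S k l‖ ^ 2) * d ε k = ((Aᴴ * W ε * A) k k).re := by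
    have h4 := sum_norm_sq_row_pos hS k
    have h5 : d ε k ^ 2 = ((Aᴴ * W ε * A) k k).re / ∑ l, ‖S k l‖ ^ 2 := by
      simp only [d, weightRatio, div_pow]
      rw [Real.sq_sqrt (Complex.nonneg_iff.1 h1).1, Real.sq_sqrt h4.le]
    calc d ε k * (∑ l, ‖S k l‖ ^ 2) * d ε k = d ε k ^ 2 * ∑ l, ‖S k l‖ ^ 2 := by ring
      _ = _ := by rw [h5, div_mul_cancel₀ _ h4.ne']
  simp only [J, D, Matrix.sub_apply, mul_diagonal, diagonal_mul]
  rw [mul_conjTranspose_apply_self, h2, ← h3]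
  push_cast
  ring

end certificate

end WAN

/-! ### Weak duality, the explicit optimal point, and recovery of the frequencies. -/

namespace WAN

section duality

variable {N K L : ℕ} {W : Matrix (Fin N) (Fin N) ℂ} {Y Q : Matrix (Fin N) (Fin L) ℂ}
  {X : Matrix (Fin L) (Fin L) ℂ} {T : Matrix (Fin N) (Fin N) ℂ}

lemma Feasible.posSemidef (h : Feasible Y X T) : T.PosSemidef := by
  have := h.1.submatrix Sum.inr
  rwa [show (fromBlocks X Yᴴ Y T).submatrix Sum.inr Sum.inr = T from rfl] at this

/-- Weak duality for the semidefinite program. -/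
lemma Feasible.le_objective (h : Feasible Y X T) (Q : Matrix (Fin N) (Fin L) ℂ) :
    (Qᴴ * Y).trace.re + 1 / 2 * ((W - Q * Qᴴ) * T).trace.re ≤ objective W X T := by
  -- Compressing the block matrix to (1; −Q) and taking traces gives tr X − 2 Re tr(QᴴY) + tr(QQᴴT)
  -- ≥ 0.
  have h1 := h.1.conjTranspose_mul_mul_same
    (fromRows (1 : Matrix (Fin L) (Fin L) ℂ) (-Q))
  have h2 : (fromRows (1 : Matrix (Fin L) (Fin L) ℂ) (-Q))ᴴ * fromBlocks X Yᴴ Y T *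
      fromRows (1 : Matrix (Fin L) (Fin L) ℂ) (-Q) =
      X - Qᴴ * Y - (Yᴴ * Q - Qᴴ * T * Q) := by
    rw [conjTranspose_fromRows_eq_fromCols_conjTranspose, fromCols_mul_fromBlocks,
      fromCols_mul_fromRows]
    simp only [conjTranspose_one, conjTranspose_neg, Matrix.one_mul, Matrix.mul_one,
      Matrix.neg_mul, Matrix.mul_neg, Matrix.add_mul]
    abel
  rw [h2] at h1
  have h3 := (Complex.nonneg_iff.1 h1.trace_nonneg).1
  have h4 : (Yᴴ * Q).trace.re = (Qᴴ * Y).trace.re := by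
    have : Yᴴ * Q = (Qᴴ * Y)ᴴ := by simp
    rw [this, trace_conjTranspose]
    simp
  have h5 : (Qᴴ * T * Q).trace = (Q * Qᴴ * T).trace := by
    rw [trace_mul_comm, Matrix.mul_assoc]
  simp only [trace_sub, Complex.sub_re, h4, h5] at h3
  rw [objective, Matrix.sub_mul, trace_sub, Complex.sub_re]
  linarith

lemma trace_mul_vecMulVec_star (M : Matrix (Fin N) (Fin N) ℂ) (a : Fin N → ℂ) :
    (M * vecMulVec a (star a)).trace = star a ⬝ᵥ (M *ᵥ a) := by
  rw [mul_vecMulVec, trace_vecMulVec, dotProduct_comm]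

lemma isToeplitz_vecMulVec_sinusoid (g : UnitAddCircle) :
    IsToeplitz (vecMulVec (sinusoid N g) (star (sinusoid N g))) := by
  refine ⟨fun m => fourier m g, fun i j => ?_⟩
  simp only [vecMulVec_apply, sub_eq_add_neg, fourier_add, fourier_neg]
  rfl

lemma isToeplitz_vandermondeMatrix_mul (f : Fin K → UnitAddCircle) (p : Fin K → ℂ) :
    IsToeplitz (vandermondeMatrix N f * diagonal p * (vandermondeMatrix N f)ᴴ) := by
  refine ⟨fun m => ∑ k, p k * fourier m (f k), fun i j => ?_⟩
  rw [mul_apply]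
  refine Finset.sum_congr rfl fun k _ => ?_
  rw [sub_eq_add_neg, fourier_add, fourier_neg, mul_diagonal, conjTranspose_apply]
  simp only [vandermondeMatrix, of_apply, sinusoid, Complex.star_def]
  ring

lemma weight_eq_sqrt (f : Fin K → UnitAddCircle) (k : Fin K) :
    weight W (f k) =
      Real.sqrt (((vandermondeMatrix N f)ᴴ * W * vandermondeMatrix N f) k k).re := by
  rw [weight, Matrix.mul_assoc, mul_apply]
  rfl

/-- The dual certificate bounds the cost of every atomic decomposition from below. -/
lemma le_of_mem_atomicCosts (hQ : ∀ T : Matrix (Fin N) (Fin N) ℂ, T.PosSemidef → IsToeplitz T →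
      0 ≤ ((W - Q * Qᴴ) * T).trace.re) {r : ℝ} (hr : r ∈ atomicCosts (weight W) Y) :
    (Qᴴ * Y).trace.re ≤ r := by
  obtain ⟨n, c, g, φ, hc, hφ, rfl, rfl⟩ := hr
  -- Testing the hypothesis on the rank-one Toeplitz matrix a(g)a(g)ᴴ yields ‖Qᴴa(g)‖ ≤ w(g), the
  -- dual norm constraint.
  have hnorm : ∀ g, ∑ l, ‖(Qᴴ *ᵥ sinusoid N g) l‖ ^ 2 ≤
      (star (sinusoid N g) ⬝ᵥ (W *ᵥ sinusoid N g)).re := fun g => by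
    have h := hQ _ (posSemidef_vecMulVec_self_star (sinusoid N g)) (isToeplitz_vecMulVec_sinusoid g)
    have h2 := star_dotProduct_conjTranspose_mul_mulVec Qᴴ Qᴴ (sinusoid N g)
    rw [conjTranspose_conjTranspose, star_dotProduct_self] at h2
    rw [trace_mul_vecMulVec_star, sub_mulVec, dotProduct_sub, h2, Complex.sub_re,
      Complex.ofReal_re] at h
    linarith
  have hatom : ∀ k, (Qᴴ * atom N (g k) (φ k)).trace.re ≤ weight W (g k) := fun k => by
    have h1 : (Qᴴ * atom N (g k) (φ k)).trace = (Qᴴ *ᵥ sinusoid N (g k)) ⬝ᵥ (φ k).ofLp := by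
      have : atom N (g k) (φ k) = vecMulVec (sinusoid N (g k)) (φ k).ofLp := rfl
      rw [this, mul_vecMulVec, trace_vecMulVec]
    have h2 := norm_dotProduct_sq_le (Qᴴ *ᵥ sinusoid N (g k)) (φ k).ofLp
    have h3 : ∑ l, ‖(φ k).ofLp l‖ ^ 2 = 1 := by
      rw [← EuclideanSpace.norm_sq_eq, hφ k, one_pow]
    rw [h3, mul_one] at h2
    rw [h1]
    exact (Complex.re_le_norm _).trans (Real.le_sqrt_of_sq_le (h2.trans (hnorm (g k))))
  rw [Matrix.mul_sum, trace_sum, Complex.re_sum]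
  refine Finset.sum_le_sum fun k _ => ?_
  rw [Matrix.mul_smul, trace_smul, smul_eq_mul, Complex.re_ofReal_mul, mul_comm (weight W (g k))]
  exact mul_le_mul_of_nonneg_left (hatom k) (hc k).le

end duality

section truth

variable {N K L : ℕ} {W : Matrix (Fin N) (Fin N) ℂ} {f : Fin K → UnitAddCircle}
  {S : Matrix (Fin K) (Fin L) ℂ} {d : Fin K → ℝ}

lemma trace_conjTranspose_mul_diagonal_mul (S : Matrix (Fin K) (Fin L) ℂ) (d : Fin K → ℝ) :
    (Sᴴ * diagonal (fun k => (d k : ℂ)) * S).trace =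
      ((∑ k, d k * ∑ l, ‖S k l‖ ^ 2 : ℝ) : ℂ) := by
  rw [trace_mul_comm, ← Matrix.mul_assoc, trace, Complex.ofReal_sum]
  refine Finset.sum_congr rfl fun k _ => ?_
  rw [diag_apply, mul_diagonal, mul_conjTranspose_apply_self]
  push_cast
  ring

/-- The block matrix factors as M D⁻¹ Mᴴ, with M formed by stacking SᴴD on A. -/
lemma feasible_truth (hd : ∀ k, 0 < d k) :
    Feasible (vandermondeMatrix N f * S) (Sᴴ * diagonal (fun k => (d k : ℂ)) * S)
      (vandermondeMatrix N f * diagonal (fun k => (d k : ℂ)⁻¹) * (vandermondeMatrix N f)ᴴ) := by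
  refine ⟨?_, isToeplitz_vandermondeMatrix_mul f _⟩
  have hD : (diagonal fun k => (d k : ℂ)⁻¹).PosSemidef := by
    refine PosSemidef.diagonal fun k => ?_
    simpa using (hd k).le
  have h := hD.mul_mul_conjTranspose_same
    (fromRows (Sᴴ * diagonal (fun k => (d k : ℂ))) (vandermondeMatrix N f))
  have h1 : (diagonal fun k => (d k : ℂ)) * (diagonal fun k => (d k : ℂ)⁻¹) = 1 := by
    rw [diagonal_mul_diagonal, ← diagonal_one]
    congr 1
    ext k
    exact mul_inv_cancel₀ (Complex.ofReal_ne_zero.2 (hd k).ne')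
  have h2 : (diagonal fun k => (d k : ℂ)⁻¹) * (diagonal fun k => (d k : ℂ)) = 1 := by
    rw [diagonal_mul_diagonal, ← diagonal_one]
    congr 1
    ext k
    exact inv_mul_cancel₀ (Complex.ofReal_ne_zero.2 (hd k).ne')
  have h3 : (diagonal fun k => (d k : ℂ))ᴴ = diagonal fun k => (d k : ℂ) := by
    rw [diagonal_conjTranspose]
    congr 1
    ext k
    simp
  rw [conjTranspose_fromRows_eq_fromCols_conjTranspose, fromRows_mul, fromRows_mul_fromCols,
    conjTranspose_mul, conjTranspose_conjTranspose, h3, Matrix.mul_assoc Sᴴ, h1, Matrix.mul_one,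
    Matrix.mul_assoc _ _ (_ * S), ← Matrix.mul_assoc (diagonal fun k => (d k : ℂ)⁻¹) _ S, h2,
    Matrix.one_mul] at h
  rwa [conjTranspose_mul, Matrix.mul_assoc Sᴴ]

lemma weight_eq_weightRatio_mul (hS : S.rank = K) (k : Fin K) :
    weight W (f k) =
      weightRatio W (vandermondeMatrix N f) S k * Real.sqrt (∑ l, ‖S k l‖ ^ 2) := by
  rw [weight_eq_sqrt, weightRatio, div_mul_cancel₀]
  exact (Real.sqrt_pos.2 (sum_norm_sq_row_pos hS k)).ne'

/-- The ratios d_k balance the two halves of the objective: tr X and tr(WT) are both ∑ d_k‖S_k‖². -/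
lemma objective_truth (hW : W.PosSemidef) (hS : S.rank = K)
    (hd : ∀ k, 0 < weightRatio W (vandermondeMatrix N f) S k) :
    objective W
      (Sᴴ * diagonal (fun k => (weightRatio W (vandermondeMatrix N f) S k : ℂ)) * S)
      (vandermondeMatrix N f * diagonal
        (fun k => (weightRatio W (vandermondeMatrix N f) S k : ℂ)⁻¹) *
          (vandermondeMatrix N f)ᴴ) =
      ∑ k, weightRatio W (vandermondeMatrix N f) S k * ∑ l, ‖S k l‖ ^ 2 := by
  set A := vandermondeMatrix N f with hA
  have h1 : (W * (A * diagonal (fun k => (weightRatio W A S k : ℂ)⁻¹) * Aᴴ)).trace.re =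
      ∑ k, weightRatio W A S k * ∑ l, ‖S k l‖ ^ 2 := by
    rw [← Matrix.mul_assoc, trace_mul_comm, ← Matrix.mul_assoc, ← Matrix.mul_assoc, trace,
      Complex.re_sum]
    refine Finset.sum_congr rfl fun k _ => ?_
    have h2 : 0 ≤ ((Aᴴ * W * A) k k).re :=
      (Complex.nonneg_iff.1 (hW.conjTranspose_mul_mul_same A).diag_nonneg).1
    have h3 := weight_eq_weightRatio_mul (W := W) (f := f) hS k
    rw [weight_eq_sqrt, ← hA] at h3
    have h4 : ((Aᴴ * W * A) k k).re = weightRatio W A S k ^ 2 * ∑ l, ‖S k l‖ ^ 2 := by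
      rw [← Real.sq_sqrt h2, h3, mul_pow, Real.sq_sqrt (sum_norm_sq_row_pos hS k).le]
    rw [diag_apply, mul_diagonal, mul_comm, ← Complex.ofReal_inv, Complex.re_ofReal_mul, h4]
    have := (hd k).ne'
    field_simp
  rw [objective, h1, trace_conjTranspose_mul_diagonal_mul, Complex.ofReal_re]
  ring

lemma truth_mem_atomicCosts (hS : S.rank = K) :
    ∑ k, weightRatio W (vandermondeMatrix N f) S k * ∑ l, ‖S k l‖ ^ 2 ∈
      atomicCosts (weight W) (vandermondeMatrix N f * S) := by
  set σ : Fin K → ℝ := fun k => Real.sqrt (∑ l, ‖S k l‖ ^ 2) with hσ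
  have hσ0 : ∀ k, 0 < σ k := fun k => Real.sqrt_pos.2 (sum_norm_sq_row_pos hS k)
  have hσn : ∀ k, ‖WithLp.toLp 2 (S k)‖ = σ k := fun k => EuclideanSpace.norm_eq _
  refine ⟨K, σ, f, fun k => ((σ k : ℂ)⁻¹) • WithLp.toLp 2 (S k), hσ0, fun k => ?_, ?_, ?_⟩
  · rw [norm_smul, hσn, norm_inv, Complex.norm_real, Real.norm_of_nonneg (hσ0 k).le,
      inv_mul_cancel₀ (hσ0 k).ne']
  · ext i l
    rw [mul_apply, Matrix.sum_apply]
    refine Finset.sum_congr rfl fun k _ => ?_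
    have := Complex.ofReal_ne_zero.2 (hσ0 k).ne'
    simp only [vandermondeMatrix, atom, of_apply, Matrix.smul_apply, PiLp.smul_apply, smul_eq_mul]
    field_simp
  · refine Finset.sum_congr rfl fun k _ => ?_
    rw [weight_eq_weightRatio_mul hS, mul_assoc,
      Real.mul_self_sqrt (sum_norm_sq_row_pos hS k).le]

/-- A feasible Toeplitz matrix supported on the true frequencies has positive powers. -/
lemma Feasible.pos_of_eq_diagonal (hKN : K < N) (hf : Function.Injective f) (hS : S.rank = K)
    {X : Matrix (Fin L) (Fin L) ℂ} {T : Matrix (Fin N) (Fin N) ℂ}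
    (h : Feasible (vandermondeMatrix N f * S) X T) {p : Fin K → ℝ} (hp : ∀ k, 0 ≤ p k)
    (hT : T = vandermondeMatrix N f * diagonal (fun k => (p k : ℂ)) * (vandermondeMatrix N f)ᴴ)
    (k : Fin K) : 0 < p k := by
  refine lt_of_le_of_ne (hp k) fun hk => ?_
  set A := vandermondeMatrix N f with hA
  have hAΛ : Aᴴ * (lagrangeMatrix N f)ᴴ = 1 := by
    rw [← conjTranspose_mul, lagrangeMatrix_mul_vandermondeMatrix hKN hf, conjTranspose_one]
  -- The vector x below is dual to the columns of A: Aᴴx = e. If p_k = 0 then Tx = 0, so (0, x) has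
  -- zero form and lies in the kernel of the block matrix. This forces Yᴴx = Sᴴe = 0, against the
  -- full row rank of S.
  set e : Fin K → ℂ := Pi.single k 1 with he
  set x : Fin N → ℂ := (lagrangeMatrix N f)ᴴ *ᵥ e with hx
  have hAx : Aᴴ *ᵥ x = e := by rw [hx, mulVec_mulVec, hAΛ, one_mulVec]
  have hTx : T *ᵥ x = 0 := by
    rw [hT, ← mulVec_mulVec, hAx, ← mulVec_mulVec]
    have : diagonal (fun k => (p k : ℂ)) *ᵥ e = 0 := by
      ext j
      rw [mulVec_diagonal, he]
      by_cases hj : j = k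
      · subst hj; simp [← hk]
      · simp [hj]
    rw [this, mulVec_zero]
  have hblock := (h.1.dotProduct_mulVec_zero_iff (Sum.elim 0 x)).1 (by
    rw [fromBlocks_mulVec]
    simp [dotProduct, hTx])
  have hYx : (A * S)ᴴ *ᵥ x = 0 := by
    rw [fromBlocks_mulVec] at hblock
    ext l
    simpa using congrFun hblock (Sum.inl l)
  have hSe : Sᴴ *ᵥ e = 0 := by
    rwa [conjTranspose_mul, ← mulVec_mulVec, hAx] at hYx
  have hinv := congrArg conjTranspose (mul_rightInverse_of_rank_eq hS)
  rw [conjTranspose_mul, conjTranspose_one] at hinv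
  have h0 : e = 0 := by
    rw [← one_mulVec e, ← hinv, ← mulVec_mulVec, hSe, mulVec_zero]
  have := congrFun h0 k
  simp [he] at this

/-- Compression by the left inverse Λ recovers the invertible diagonal factor, so no rank is lost.
-/
lemma rank_vandermondeMatrix_mul (hKN : K < N) (hf : Function.Injective f) {p : Fin K → ℝ}
    (hp : ∀ k, 0 < p k) :
    (vandermondeMatrix N f * diagonal (fun k => (p k : ℂ)) *
      (vandermondeMatrix N f)ᴴ).rank = K := by
  set A := vandermondeMatrix N f with hA
  set Λ := lagrangeMatrix N f with hΛ
  set D : Matrix (Fin K) (Fin K) ℂ := diagonal fun k => (p k : ℂ) with hD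
  have hΛA : Λ * A = 1 := lagrangeMatrix_mul_vandermondeMatrix hKN hf
  apply le_antisymm
  · rw [Matrix.mul_assoc]
    exact (rank_mul_le_left _ _).trans (rank_le_width A)
  · have h1 : Λ * (A * D * Aᴴ) * Λᴴ = D := by
      calc Λ * (A * D * Aᴴ) * Λᴴ = (Λ * A) * D * (Λ * A)ᴴ := by
            simp only [conjTranspose_mul, Matrix.mul_assoc]
        _ = D := by rw [hΛA, conjTranspose_one, Matrix.one_mul, Matrix.mul_one]
    have h2 : D.rank = K := by
      rw [rank_of_isUnit, Fintype.card_fin]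
      rw [isUnit_iff_isUnit_det, hD, det_diagonal, isUnit_iff_ne_zero]
      exact Finset.prod_ne_zero_iff.2 fun k _ => Complex.ofReal_ne_zero.2 (hp k).ne'
    calc K = (Λ * (A * D * Aᴴ) * Λᴴ).rank := by rw [h1, h2]
      _ ≤ _ := (rank_mul_le_left _ _).trans (rank_mul_le_right _ _)

/-- The frequencies of a Toeplitz matrix annihilating the nodal polynomial are nodes. -/
lemma range_subset_of_nodeVec (hKN : K < N) {n : ℕ} {g : Fin n → UnitAddCircle} {p : Fin n → ℝ}
    (hp : ∀ k, 0 < p k) {T : Matrix (Fin N) (Fin N) ℂ}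
    (hT : T = vandermondeMatrix N g * diagonal (fun k => (p k : ℂ)) * (vandermondeMatrix N g)ᴴ)
    (h0 : nodeVec N f ⬝ᵥ (T *ᵥ star (nodeVec N f)) = 0) : Set.range g ⊆ Set.range f := by
  set u := nodeVec N f ᵥ* vandermondeMatrix N g with hu
  have h1 : nodeVec N f ⬝ᵥ (T *ᵥ star (nodeVec N f)) =
      ((∑ k, p k * ‖u k‖ ^ 2 : ℝ) : ℂ) := by
    rw [hT, ← mulVec_mulVec, ← mulVec_mulVec, dotProduct_mulVec, ← hu, ← star_vecMul, ← hu,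
      dotProduct, Complex.ofReal_sum]
    refine Finset.sum_congr rfl fun k _ => ?_
    rw [mulVec_diagonal, Pi.star_apply, Complex.star_def, mul_left_comm, Complex.mul_conj']
    push_cast
    ring
  rw [h1, Complex.ofReal_eq_zero,
    Finset.sum_eq_zero_iff_of_nonneg fun k _ => mul_nonneg (hp k).le (sq_nonneg _)] at h0
  rintro _ ⟨k, rfl⟩
  rw [← eval_nodePoly_eq_zero_iff, ← nodeVec_dotProduct_sinusoid hKN]
  have h2 := h0 k (Finset.mem_univ k)
  have h3 : u k = 0 := by simpa [(hp k).ne'] using h2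
  exact h3

end truth

end WAN

/-! ### Assembly of primal point, dual bound and uniqueness of the support. -/

theorem theorem1 (N L K : ℕ) (hKN : K < N)
    (f : Fin K → UnitAddCircle) (hf : Function.Injective f)
    (S : Matrix (Fin K) (Fin L) ℂ) (hS : S.rank = K)
    (Y : Matrix (Fin N) (Fin L) ℂ) (hY : Y = WAN.vandermondeMatrix N f * S) :
    ∃ ε₀ : ℝ, 0 < ε₀ ∧ ∀ ε : ℝ, 0 < ε → ε ≤ ε₀ →
      -- the minimum of the semidefinite program is attained and is the weighted atomic norm
      IsLeast (WAN.objectiveValues (WAN.weightMatrix ε Y) Y)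
        (WAN.weightedAtomicNorm (WAN.weight (WAN.weightMatrix ε Y)) Y) ∧
      -- every optimal Toeplitz matrix has a Vandermonde decomposition, and every such
      -- decomposition consists of exactly the true frequencies
      ∀ (X : Matrix (Fin L) (Fin L) ℂ) (T : Matrix (Fin N) (Fin N) ℂ),
        WAN.IsOptimal (WAN.weightMatrix ε Y) Y X T →
          (∃ (n : ℕ) (g : Fin n → UnitAddCircle) (p : Fin n → ℝ),
            WAN.IsVandermondeDecomposition T g p) ∧
          ∀ (n : ℕ) (g : Fin n → UnitAddCircle) (p : Fin n → ℝ),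
            WAN.IsVandermondeDecomposition T g p → n = K ∧ Set.range g = Set.range f := by
  obtain ⟨ε₀, hε₀, hcert⟩ := WAN.exists_certificate_weightMatrix hKN hf hS hY
  refine ⟨ε₀, hε₀, fun ε hε hle => ?_⟩
  obtain ⟨Q, hQA, δ, hδ, hQ⟩ := hcert ε hε hle
  have hΛ := WAN.lagrangeMatrix_mul_vandermondeMatrix hKN hf
  have hW := (WAN.weightMatrix_posDef Y hε).posSemidef
  set W := WAN.weightMatrix ε Y with hWdef
  have hd : ∀ k, 0 < WAN.weightRatio W (WAN.vandermondeMatrix N f) S k :=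
    WAN.weightRatio_pos hΛ hS hε
  set v : ℝ := ∑ k, WAN.weightRatio W (WAN.vandermondeMatrix N f) S k * ∑ l, ‖S k l‖ ^ 2 with hv
  have hnode : ∀ {T : Matrix (Fin N) (Fin N) ℂ}, T.PosSemidef →
      0 ≤ WAN.nodeVec N f ⬝ᵥ (T *ᵥ star (WAN.nodeVec N f)) := fun hT => by
    have := hT.dotProduct_mulVec_nonneg (star (WAN.nodeVec N f))
    rwa [star_star] at this
  have hQY : (Qᴴ * Y).trace.re = v := by
    rw [hY, ← Matrix.mul_assoc, hQA, WAN.trace_conjTranspose_mul_diagonal_mul, Complex.ofReal_re]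
  have hdual : ∀ {X T}, WAN.Feasible Y X T →
      v + 1 / 2 * (δ * (WAN.nodeVec N f ⬝ᵥ (T *ᵥ star (WAN.nodeVec N f))).re) ≤
        WAN.objective W X T := fun hXT => by
    have h1 := hXT.le_objective (W := W) Q
    have h2 := hQ _ hXT.posSemidef hXT.2
    linarith
  have hfeas := WAN.feasible_truth (N := N) (f := f) (S := S) hd
  rw [← hY] at hfeas
  have hobj := WAN.objective_truth hW hS hd
  have hnorm : WAN.weightedAtomicNorm (WAN.weight W) Y = v := by
    refine IsLeast.csInf_eq ⟨?_, fun r hr => ?_⟩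
    · rw [hY]
      exact WAN.truth_mem_atomicCosts hS
    · rw [← hQY]
      refine WAN.le_of_mem_atomicCosts (fun T hT hTo => ?_) hr
      exact (mul_nonneg hδ.le (Complex.nonneg_iff.1 (hnode hT)).1).trans (hQ T hT hTo)
  rw [hnorm]
  refine ⟨⟨⟨_, _, hfeas, hobj.symm⟩, ?_⟩, fun X T hopt => ?_⟩
  · rintro _ ⟨X, T, hXT, rfl⟩
    have h1 := hdual hXT
    have h2 := mul_nonneg hδ.le (Complex.nonneg_iff.1 (hnode hXT.posSemidef)).1
    linarith
  -- The optimal value is v, so the surplus term of `hdual` must vanish; here δ > 0 is essential.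
  · have h0 : WAN.nodeVec N f ⬝ᵥ (T *ᵥ star (WAN.nodeVec N f)) = 0 := by
      have h1 := hdual hopt.1
      have h2 := hopt.2 _ _ hfeas
      rw [hobj] at h2
      have h3 := Complex.nonneg_iff.1 (hnode hopt.1.posSemidef)
      have h4 : δ * (WAN.nodeVec N f ⬝ᵥ (T *ᵥ star (WAN.nodeVec N f))).re ≤ 0 := by linarith
      have h5 := nonpos_of_mul_nonpos_right h4 hδ
      exact Complex.ext (le_antisymm h5 h3.1) h3.2.symm
    obtain ⟨p, hp, hT⟩ :=
      WAN.IsToeplitz.exists_eq_diagonal hKN hf hopt.1.posSemidef hopt.1.2 h0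
    have hp0 := WAN.Feasible.pos_of_eq_diagonal hKN hf hS (hY ▸ hopt.1) hp hT
    have hrank : T.rank = K := by
      rw [hT]
      exact WAN.rank_vandermondeMatrix_mul hKN hf hp0
    refine ⟨⟨K, f, p, hf, hp0, hrank.symm, hT⟩, ?_⟩
    rintro n g p' ⟨hg, hp', hn, hT'⟩
    have hnK : n = K := hn.trans hrank
    refine ⟨hnK, ?_⟩
    have hsub := WAN.range_subset_of_nodeVec hKN hp' hT' h0
    refine Set.eq_of_subset_of_ncard_le hsub ?_ (Set.finite_range f)
    rw [← Set.image_univ, ← Set.image_univ, Set.ncard_image_of_injective _ hf,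
      Set.ncard_image_of_injective _ hg, Set.ncard_univ, Set.ncard_univ]
    simp [hnK]
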